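/- **Setting.** Work in the internal language of a Grothendieck topos $\mathcal E=\mathrm{Sh}(\mathcal C,J)$ with a commutative $\mathbb Q$-algebra object $R$ satisfying the general Kock–Lawvere axiom: for every Weil algebra $W$ over $\mathbb Q$ (finite-dimensional commutative $\mathbb Q$-algebra with an augmentation $W\to\mathbb Q$ whose kernel is nilpotent) the canonical map $R\otimes_{\mathbb Q} W\to R^{\mathrm{Spec}_R W}$ is invertible, where $\mathrm{Spec}_R W$ is the object of $\mathbb Q$-algebra maps $W\to R$. Let $D(n)=\{d\in R^n\mid d_id_j=0 \text{ for all } i,j\}$. In any object $X$ write $x\sim y$ ($x$ and $y$ are *neighbours*) if, for some $m$, there are a map $f:D(m)\to X$ and $d\in D(m)$ with $f(0)=x$, $f(d)=y$; in $R^n$ (and hence in charts) this says $y-x\in D(n)$. A subset is *formally open* if it is closed under $\sim$. A *(formal) manifold* is an object $M$ in which each point lies in a formally open subset that is isomorphic to a formally open subset of some $R^n$; on a manifold $\sim$ is reflexive and symmetric. Write $x\sim_\infty y$ if there is a finite path $x\sim y_1\sim\dots\sim y$; the *$\infty$-monad* of $x_0\in M$ is $\mathfrak M_\infty(x_0)=\{y\mid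 x_0\sim_\infty y\}$. An *affine connection* on $M$ is a map $(x,y,z)\mapsto\lambda(x,y,z)\in M$, defined for $y\sim x\sim z$, such that $\lambda(x,y,z)\sim y$, $\lambda(x,y,z)\sim z$, $\lambda(x,x,z)=z$, $\lambda(x,y,x)=y$ and $\lambda(y,x,\lambda(x,y,z))=z$. It is *symmetric* if $\lambda(x,y,z)=\lambda(x,z,y)$, and *flat* if $\lambda(y,z,\lambda(x,y,t))=\lambda(x,z,t)$ whenever $x,y,z$ are mutual neighbours and $t\sim x$. An *affine space over $\mathbb Z$* is a set with operations $(x_1,\dots,x_n)\mapsto\sum a_ix_i$, one for each tuple of integers $a_i$ with $\sum a_i=1$, such that the tuple $(0,\dots,1,\dots,0)$ with $1$ in position $i$ gives $x_i$, and $\sum_i a_i\bigl(\sum_j b_{ij}x_j\bigr)=\sum_j\bigl(\sum_i a_ib_{ij}\bigr)x_j$. **Theorem.** Let $M$ be a manifold with a symmetric and flat affine connection $\lambda$. Then every $\infty$-monad $\mathfrak M_\infty(x_0)$ of $M$ (for every generalized point $x_0$ of $M$, at any stage) carries a unique structure of affine space over $\mathbb Z$ such that $$\lambda(x,y,z)=y-x+z\qquad\text{for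 all } x,y,z\in\mathfrak M_\infty(x_0)\text{ with } y\sim x\sim z .$$ -/

import Mathlib

open CategoryTheory Opposite
open scoped TensorProduct

/-! Everything is interpreted in the Grothendieck topos of sheaves on a site `(C, J)`, through
generalized elements: a point of an object `X` *at stage* `c` is an element of `X.obj (op c)`,
a map out of a (partially defined) object is a family of functions that is natural in the stage,
and an internal `∃` means existence after restriction along some covering sieve. -/

universe v u w w'

namespace SDG

variable {C : Type u} [Category.{v} C]

/-- Restriction of a generalized point along `g : b ⟶ c`. -/
abbrev res (X : Cᵒᵖ ⥤ Type w') {b c : C} (g : b ⟶ c) (x : X.obj (op c)) : X.obj (op b) :=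
  X.map g.op x

/-- Restriction of a generalized scalar along `g : b ⟶ c`, as an algebra homomorphism. -/
abbrev resR (R : Cᵒᵖ ⥤ CommAlgCat.{w} ℚ) {b c : C} (g : b ⟶ c) :
    R.obj (op c) →ₐ[ℚ] R.obj (op b) :=
  (R.map g.op).hom

/-- Weil algebras over `ℚ`: finite dimensional commutative `ℚ`-algebras with an augmentation to
`ℚ` whose kernel is a nilpotent ideal. -/
def IsWeilAlgebra (W : Type) [CommRing W] [Algebra ℚ W] : Prop :=
  Module.Finite ℚ W ∧ ∃ π : W →ₐ[ℚ] ℚ, IsNilpotent (RingHom.ker π)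

/-- The general Kock–Lawvere axiom: for each Weil algebra `W`, the canonical map
`R ⊗ W ⟶ R ^ (Spec_R W)` is invertible, where the infinitesimal object `Spec_R W` has the algebra
homomorphisms `W →ₐ[ℚ] R.obj (op b)` as its points at stage `b`. A point of the exponential at
stage `c` is a function of the points of `Spec_R W` at all stages over `c`, natural in the
stage. -/
def KockLawvere (R : Cᵒᵖ ⥤ CommAlgCat.{w} ℚ) : Prop :=
  ∀ (W : Type) [CommRing W] [Algebra ℚ W], IsWeilAlgebra W →
    ∀ (c : C) (f : ∀ ⦃b : C⦄, (b ⟶ c) → (W →ₐ[ℚ] R.obj (op b)) → R.obj (op b)),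
      (∀ ⦃a b : C⦄ (h : a ⟶ b) (g : b ⟶ c) (s : W →ₐ[ℚ] R.obj (op b)),
        f (h ≫ g) ((resR R h).comp s) = resR R h (f g s)) →
      ∃! t : R.obj (op c) ⊗[ℚ] W, ∀ ⦃b : C⦄ (g : b ⟶ c) (s : W →ₐ[ℚ] R.obj (op b)),
        f g s = Algebra.TensorProduct.productMap (resR R g) s t

/-- The first order neighbour relation of the coordinate space `Rⁿ`, over a ring `A` of scalars:
`v - u` lies in `D(n) = {d | ∀ i j, d i * d j = 0}`. -/
def CoordNbr {A : Type w} [CommRing A] {n : ℕ} (u v : Fin n → A) : Prop :=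
  ∀ i j, (v i - u i) * (v j - u j) = 0

/-- A figure `D(m) ⟶ X` at stage `c`: a map into `X` from the object `D(m)` of first order
neighbours of `0 ∈ Rᵐ`, defined at all stages over `c`. -/
structure Figure (R : Cᵒᵖ ⥤ CommAlgCat.{w} ℚ) (X : Cᵒᵖ ⥤ Type w') (m : ℕ) (c : C) where
  toFun : ∀ ⦃b : C⦄, (b ⟶ c) → {d : Fin m → R.obj (op b) // CoordNbr 0 d} → X.obj (op b)
  natural : ∀ ⦃a b : C⦄ (h : a ⟶ b) (g : b ⟶ c)
    (d : {d : Fin m → R.obj (op b) // CoordNbr 0 d})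
    (d' : {d : Fin m → R.obj (op a) // CoordNbr 0 d}),
    (∀ i, d'.1 i = resR R h (d.1 i)) → toFun (h ≫ g) d' = res X h (toFun g d)

variable (J : GrothendieckTopology C) (R : Cᵒᵖ ⥤ CommAlgCat.{w} ℚ)

/-- The first order neighbour relation `x ∼ y`: locally, `y` is the value at some `d ∈ D(m)` of
a map `D(m) ⟶ X` which sends `0` to `x`. For formal manifolds it says that, in a chart around
`x`, the coordinate vectors of `x` and `y` differ by an element of `D(n)`. -/
def Nbr (X : Cᵒᵖ ⥤ Type w') {c : C} (x y : X.obj (op c)) : Prop :=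
  ∃ S ∈ J c, ∀ ⦃b : C⦄ (g : b ⟶ c), S g →
    ∃ (m : ℕ) (f : Figure R X m b) (o d : {d : Fin m → R.obj (op b) // CoordNbr 0 d}),
      o.1 = 0 ∧ f.toFun (𝟙 b) o = res X g x ∧ f.toFun (𝟙 b) d = res X g y

theorem Nbr.restrict {X : Cᵒᵖ ⥤ Type w'} {c : C} {x y : X.obj (op c)} (hxy : Nbr J R X x y)
    {b : C} (g : b ⟶ c) : Nbr J R X (res X g x) (res X g y) := by
  obtain ⟨S, hS, H⟩ := hxy
  refine ⟨S.pullback g, J.pullback_stable g hS, fun a h hh => ?_⟩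
  obtain ⟨m, f, o, d, ho, h0, h1⟩ := H (h ≫ g) hh
  refine ⟨m, f, o, d, ho, ?_, ?_⟩
  · simpa [res] using h0
  · simpa [res] using h1

/-- A chart of dimension `n` on `M` at stage `c`: a formally open subset of `Rⁿ` (a subsheaf closed
under the neighbour relation), and an injective map from it to `M` whose image is formally open in
`M`. The subset and the map are defined at all stages over `c`. -/
structure Chart (M : Cᵒᵖ ⥤ Type w') (n : ℕ) (c : C) where
  dom : ∀ ⦃b : C⦄, (b ⟶ c) → Set (Fin n → R.obj (op b))
  dom_res : ∀ ⦃a b : C⦄ (h : a ⟶ b) (g : b ⟶ c) (p : Fin n → R.obj (op b)),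
    p ∈ dom g → (fun i => resR R h (p i)) ∈ dom (h ≫ g)
  dom_local : ∀ ⦃b : C⦄ (g : b ⟶ c) (p : Fin n → R.obj (op b)),
    (∃ S ∈ J b, ∀ ⦃a : C⦄ (h : a ⟶ b), S h → (fun i => resR R h (p i)) ∈ dom (h ≫ g)) → p ∈ dom g
  dom_open : ∀ ⦃b : C⦄ (g : b ⟶ c) (p q : Fin n → R.obj (op b)),
    p ∈ dom g → CoordNbr p q → q ∈ dom g
  map : ∀ ⦃b : C⦄ (g : b ⟶ c), dom g → M.obj (op b)
  map_natural : ∀ ⦃a b : C⦄ (h : a ⟶ b) (g : b ⟶ c) (p : dom g),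
    map (h ≫ g) ⟨fun i => resR R h (p.1 i), dom_res h g p.1 p.2⟩ = res M h (map g p)
  map_injective : ∀ ⦃b : C⦄ (g : b ⟶ c), Function.Injective (map g)
  range_open : ∀ ⦃b : C⦄ (g : b ⟶ c) (x y : M.obj (op b)),
    x ∈ Set.range (map g) → Nbr J R M x y → y ∈ Set.range (map g)

/-- Formal manifolds: locally, every point lies in a chart. -/
def IsFormalManifold (M : Cᵒᵖ ⥤ Type w') : Prop :=
  ∀ ⦃c : C⦄ (x : M.obj (op c)), ∃ S ∈ J c, ∀ ⦃b : C⦄ (g : b ⟶ c), S g →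
    ∃ (n : ℕ) (χ : Chart J R M n b), res M g x ∈ Set.range (χ.map (𝟙 b))

/-- Affine connections: a map `(x, y, z) ↦ λ(x, y, z)` (the translate of `z` along `x`, `y`),
defined for `x ∼ y` and `x ∼ z`, subject to the book-keeping laws `y ∼ λ(x, y, z) ∼ z`, the unit
laws and the inversion law. (On a formal manifold `∼` is reflexive and symmetric, so `x ∼ x` and
`y ∼ x` hold automatically in the unit and inversion laws.) -/
structure AffineConnection (M : Cᵒᵖ ⥤ Type w') where
  lam : ∀ ⦃c : C⦄ (x y z : M.obj (op c)), Nbr J R M x y → Nbr J R M x z →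
    M.obj (op c)
  natural : ∀ ⦃b c : C⦄ (g : b ⟶ c) (x y z : M.obj (op c)) (hy : Nbr J R M x y)
    (hz : Nbr J R M x z),
    lam (res M g x) (res M g y) (res M g z) (hy.restrict J R g) (hz.restrict J R g) =
      res M g (lam x y z hy hz)
  nbr_left : ∀ ⦃c : C⦄ (x y z : M.obj (op c)) (hy : Nbr J R M x y)
    (hz : Nbr J R M x z), Nbr J R M y (lam x y z hy hz)
  nbr_right : ∀ ⦃c : C⦄ (x y z : M.obj (op c)) (hy : Nbr J R M x y)
    (hz : Nbr J R M x z), Nbr J R M z (lam x y z hy hz)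
  unit_left : ∀ ⦃c : C⦄ (x z : M.obj (op c)) (hx : Nbr J R M x x)
    (hz : Nbr J R M x z), lam x x z hx hz = z
  unit_right : ∀ ⦃c : C⦄ (x y : M.obj (op c)) (hy : Nbr J R M x y)
    (hx : Nbr J R M x x), lam x y x hy hx = y
  inversion : ∀ ⦃c : C⦄ (x y z : M.obj (op c)) (hy : Nbr J R M x y)
    (hz : Nbr J R M x z) (hyx : Nbr J R M y x),
    lam y x (lam x y z hy hz) hyx (nbr_left x y z hy hz) = z

variable {J R}

/-- Symmetric (torsion free) affine connections. -/
def AffineConnection.Symmetric {M : Cᵒᵖ ⥤ Type w'} (L : AffineConnection J R M) : Prop :=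
  ∀ ⦃c : C⦄ (x y z : M.obj (op c)) (hy : Nbr J R M x y) (hz : Nbr J R M x z),
    L.lam x y z hy hz = L.lam x z y hz hy

/-- Flat (curvature free) affine connections: for mutual neighbours `x`, `y`, `z`, translating any
neighbour `t` of `x` first along `x`, `y` and then along `y`, `z` is the same as translating it
along `x`, `z`. -/
def AffineConnection.Flat {M : Cᵒᵖ ⥤ Type w'} (L : AffineConnection J R M) : Prop :=
  ∀ ⦃c : C⦄ (x y z t : M.obj (op c)) (hxy : Nbr J R M x y) (hyz : Nbr J R M y z)
    (hxz : Nbr J R M x z) (hxt : Nbr J R M x t),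
    L.lam y z (L.lam x y t hxy hxt) hyz (L.nbr_left x y t hxy hxt) = L.lam x z t hxz hxt

variable (J R)

/-- The relation `x ∼_∞ y`: locally, there is a finite path `x ∼ y₁ ∼ y₂ ∼ ⋯ ∼ y`. -/
def NbrInfty (X : Cᵒᵖ ⥤ Type w') {c : C} (x y : X.obj (op c)) : Prop :=
  ∃ S ∈ J c, ∀ ⦃b : C⦄ (g : b ⟶ c), S g →
    Relation.ReflTransGen (fun p q : X.obj (op b) => Nbr J R X p q) (res X g x) (res X g y)

theorem NbrInfty.restrict {X : Cᵒᵖ ⥤ Type w'} {c : C} {x y : X.obj (op c)}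
    (hxy : NbrInfty J R X x y) {b : C} (g : b ⟶ c) :
    NbrInfty J R X (res X g x) (res X g y) := by
  obtain ⟨S, hS, H⟩ := hxy
  refine ⟨S.pullback g, J.pullback_stable g hS, fun a h hh => ?_⟩
  simpa [res] using H (h ≫ g) hh

/-- The `∞`-monad (infinitesimal path component) of a point `x` at stage `c`, a subobject of `M`
defined at all stages `g : b ⟶ c` over `c`. -/
def inftyMonad (M : Cᵒᵖ ⥤ Type w') {c : C} (x : M.obj (op c)) ⦃b : C⦄ (g : b ⟶ c) :
    Set (M.obj (op b)) :=
  {y | NbrInfty J R M (res M g x) y}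

/-- Restriction of points of the `∞`-monad of `x` along `h : a ⟶ b` over `c`. -/
def inftyMonad.res {M : Cᵒᵖ ⥤ Type w'} {c : C} {x : M.obj (op c)} {a b : C} (h : a ⟶ b)
    (g : b ⟶ c) (y : inftyMonad J R M x g) : inftyMonad J R M x (h ≫ g) :=
  ⟨SDG.res M h y.1, by
    have := NbrInfty.restrict J R y.2 h
    simpa [inftyMonad, SDG.res] using this⟩

/-- Affine space structures over a commutative ring `A`: for all coefficients `a₁, …, aₙ` with
sum `1`, the affine combination `a₁ x₁ + ⋯ + aₙ xₙ` of any points can be formed. The laws: the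
combination with coefficients `(0, …, 1, …, 0)` is the `i`-th point, and an affine combination
(coefficients `a`) of affine combinations (coefficients the rows of `B`) of `x₁, …, xₙ` is the
affine combination of `x₁, …, xₙ` with the expected coefficients. -/
structure AffineSpaceStructure (A : Type*) [CommRing A] (X : Type*) where
  comb : ∀ {n : ℕ} (a : Fin n → A), ∑ i, a i = 1 → (Fin n → X) → X
  comb_single : ∀ {n : ℕ} (i : Fin n) (x : Fin n → X) (h : ∑ j, Pi.single i (1 : A) j = 1),
    comb (Pi.single i 1) h x = x i
  comb_comb : ∀ {m n : ℕ} (a : Fin m → A) (B : Fin m → Fin n → A) (x : Fin n → X)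
    (ha : ∑ i, a i = 1) (hB : ∀ i, ∑ j, B i j = 1)
    (h : ∑ j, ∑ i, a i * B i j = 1),
    comb a ha (fun i => comb (B i) (hB i) x) = comb (fun j => ∑ i, a i * B i j) h x

/-- Structures of an affine space over `ℤ` on the `∞`-monad of `x`: an affine space structure on
its points at each stage over `c`, the operations being natural in the stage. -/
structure AffineStructureOnMonad (M : Cᵒᵖ ⥤ Type w') {c : C} (x : M.obj (op c)) where
  str : ∀ ⦃b : C⦄ (g : b ⟶ c), AffineSpaceStructure ℤ (inftyMonad J R M x g)
  natural : ∀ ⦃a b : C⦄ (h : a ⟶ b) (g : b ⟶ c) {n : ℕ} (k : Fin n → ℤ) (hk : ∑ i, k i = 1)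
    (y : Fin n → inftyMonad J R M x g),
    (str (h ≫ g)).comb k hk (fun i => inftyMonad.res J R h g (y i)) =
      inftyMonad.res J R h g ((str g).comb k hk y)

variable {J R}

/-- `λ(x, y, z) = y - x + z` for all points `x ∼ y`, `x ∼ z` of the `∞`-monad of `x₀`: the
right hand side is the affine combination of `y, x, z` with coefficients `1, -1, 1`. -/
def AffineStructureOnMonad.Extends {M : Cᵒᵖ ⥤ Type w'} {c : C} {x₀ : M.obj (op c)}
    (A : AffineStructureOnMonad J R M x₀) (L : AffineConnection J R M) : Prop :=
  ∀ ⦃b : C⦄ (g : b ⟶ c) (x y z : inftyMonad J R M x₀ g)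
    (hy : Nbr J R M x.1 y.1) (hz : Nbr J R M x.1 z.1),
    L.lam x.1 y.1 z.1 hy hz = ((A.str g).comb ![1, -1, 1] (by decide) ![y, x, z]).1

end SDG

/-! The proof integrates the connection: around every point there are coordinates φ, injective on
points joined to it by a path, in which λ(x, y, z) is literally y - x + z.

In a chart, Kock–Lawvere gives λ(p, p + d, p + e) = p + d + e + Γ_p(d)e with matrices Γ. Symmetry of
λ makes Γ symmetric, and flatness makes its curvature vanish (`flat`). A path with increments d₁,
d₂, … is developed into the tangent space at its origin: each increment is carried back by parallel
transport and the results are added. Flatness and symmetry together say that interchanging two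
consecutive increments changes neither the transport nor the developed position. So the position is
a symmetric natural function on D(n)^k.

The decisive fact (`symmetric_eq_of_sum_eq`) is that such a function depends only on ∑ dᵢ. By
Kock–Lawvere it is multi-affine, and a symmetric multi-affine form is a linear functional of ∏ (1 +
dᵢ·t). Over ℚ this product is exp(∑ dᵢ·t), since each linear form dᵢ·t has square zero. Hence the
developed position depends only on the end point, which defines φ. The same argument for the inverse
procedure, rebuilding a path from its development, shows that φ is injective.

Integral combinations are then built by subdividing parallelograms into elementary ones, each filled
by λ (`exists_parallelogram`). The outcome has the expected value in all affine coordinates, so it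
is unique wherever these exist, hence locally, and local combinations glue. For uniqueness of the
structure, y - x + z is forced by the same subdivision, and it generates all integral affine
combinations (`ext_of_tern`). -/

namespace SDG

/-- First order infinitesimal vectors: all products of two coordinates vanish. -/
def SqZero {ι : Type*} {A : Type*} [CommRing A] (d : ι → A) : Prop := ∀ i j, d i * d j = 0

/-- The coordinates of `d`, together with an extra coordinate `1`. -/
def withOne {ι : Type*} {A : Type*} [One A] (d : ι → A) (o : Option ι) : A := o.elim 1 d

@[simp] theorem withOne_none {ι : Type*} {A : Type*} [One A] (d : ι → A) :
    withOne d none = 1 := rfl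

@[simp] theorem withOne_some {ι : Type*} {A : Type*} [One A] (d : ι → A) (i : ι) :
    withOne d (some i) = d i := rfl

theorem coordNbr_zero_iff {A : Type*} [CommRing A] {n : ℕ} {d : Fin n → A} :
    CoordNbr 0 d ↔ SqZero d := by
  simp [CoordNbr, SqZero]

theorem SqZero.zero {ι : Type*} {A : Type*} [CommRing A] : SqZero (0 : ι → A) := by
  simp [SqZero]

/-! ### Symmetric multi-affine forms on square-zero vectors -/

section Symmetric

variable {A : Type*} [CommRing A] {n k : ℕ}

/-- The exponent of the monomial indexed by a choice of a variable, or `1`, for each factor. -/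
noncomputable def choiceExponent (α : Fin k → Option (Fin n)) : Fin n →₀ ℕ :=
  ∑ i, (α i).elim 0 (fun j => Finsupp.single j 1)

theorem choiceExponent_apply (α : Fin k → Option (Fin n)) (j : Fin n) :
    choiceExponent α j = Fintype.card {i // α i = some j} := by
  classical
  rw [choiceExponent, Finsupp.finsetSum_apply, Fintype.card_subtype, Finset.card_filter]
  refine Finset.sum_congr rfl fun i _ => ?_
  cases h : α i with
  | none => simp
  | some l => simp [Finsupp.single_apply]

/-- Equal exponents mean equally large fibres over every variable. The fibres over `none` then also
agree in size, as all fibres together have `k` elements, and bijections of fibres assemble to a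
permutation. -/
theorem exists_perm_of_choiceExponent_eq {α β : Fin k → Option (Fin n)}
    (h : choiceExponent α = choiceExponent β) : ∃ σ : Equiv.Perm (Fin k), α = β ∘ σ := by
  classical
  have hs : ∀ j : Fin n, Fintype.card {i // α i = some j} = Fintype.card {i // β i = some j} :=
    fun j => by rw [← choiceExponent_apply, ← choiceExponent_apply, h]
  have total : ∀ γ : Fin k → Option (Fin n),
      k = Fintype.card {i // γ i = none} + ∑ j, Fintype.card {i // γ i = some j} := by
    intro γ
    have := Finset.card_eq_sum_card_fiberwise (s := Finset.univ) (t := Finset.univ) (f := γ)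
      (fun _ _ => by simp)
    simp only [Finset.card_univ, Fintype.card_fin, Fintype.sum_option] at this
    simpa only [Fintype.card_subtype] using this
  have hn : Fintype.card {i // α i = none} = Fintype.card {i // β i = none} := by
    have h1 := total α
    have h2 := total β
    rw [Finset.sum_congr rfl fun j _ => hs j] at h1
    omega
  have e : ∀ o : Option (Fin n), Nonempty ({i // α i = o} ≃ {i // β i = o}) := by
    rintro (_ | j)
    · exact Fintype.card_eq.1 hn
    · exact Fintype.card_eq.1 (hs j)
  refine ⟨Equiv.ofFiberEquiv fun o => (e o).some, funext fun i => ?_⟩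
  exact (Equiv.ofFiberEquiv_map (fun o => (e o).some) i).symm

theorem prod_withOne_X (α : Fin k → Option (Fin n)) :
    ∏ i, withOne (MvPolynomial.X (R := A)) (α i) =
      MvPolynomial.monomial (choiceExponent α) 1 := by
  rw [choiceExponent, MvPolynomial.monomial_sum_one]
  refine Finset.prod_congr rfl fun i _ => ?_
  cases α i with
  | none => simp
  | some j => simp [MvPolynomial.X]

/-- The linear form `d · t` of a vector `d`. -/
noncomputable def genPoly (d : Fin n → A) : MvPolynomial (Fin n) A :=
  ∑ j, MvPolynomial.C (d j) * MvPolynomial.X j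

theorem genPoly_add (d e : Fin n → A) : genPoly (d + e) = genPoly d + genPoly e := by
  simp [genPoly, add_mul, Finset.sum_add_distrib]

theorem genPoly_zero : genPoly (0 : Fin n → A) = 0 := by
  simp [genPoly]

theorem genPoly_sq {d : Fin n → A} (hd : SqZero d) : genPoly d ^ 2 = 0 := by
  rw [sq, genPoly, Finset.sum_mul_sum]
  refine Finset.sum_eq_zero fun i _ => Finset.sum_eq_zero fun j _ => ?_
  rw [mul_mul_mul_comm, ← map_mul, hd i j, map_zero, zero_mul]

/-- A linear form of square zero satisfies 1 + g = exp g, and exp turns sums of commuting nilpotents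
into products. Hence the product sees only the sum of the vectors. -/
theorem prod_one_add_genPoly [Algebra ℚ A] {ι : Type*} (s : Finset ι) (d : ι → Fin n → A)
    (hd : ∀ i, SqZero (d i)) :
    IsNilpotent (genPoly (∑ i ∈ s, d i)) ∧
      ∏ i ∈ s, (1 + genPoly (d i)) = IsNilpotent.exp (genPoly (∑ i ∈ s, d i)) := by
  classical
  induction s using Finset.induction_on with
  | empty => simp [genPoly_zero]
  | insert i s hi ih =>
    have hnil : IsNilpotent (genPoly (d i)) := ⟨2, genPoly_sq (hd i)⟩
    rw [Finset.sum_insert hi, Finset.prod_insert hi, genPoly_add]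
    refine ⟨(Commute.all _ _).isNilpotent_add hnil ih.1, ?_⟩
    rw [IsNilpotent.exp_add_of_commute (Commute.all _ _) hnil ih.1, ih.2,
      IsNilpotent.exp_eq_sum (genPoly_sq (hd i))]
    simp [Finset.sum_range_succ]

theorem one_add_genPoly (d : Fin n → A) :
    1 + genPoly d = ∑ o, MvPolynomial.C (withOne d o) * withOne MvPolynomial.X o := by
  simp [genPoly, Fintype.sum_option]

/-- A symmetric multi-affine form takes the same value at two tuples of first order infinitesimal
vectors with the same sum. -/
theorem symmetric_multiaffine_eq [Algebra ℚ A] (c : (Fin k → Option (Fin n)) → A)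
    (hc : ∀ (σ : Equiv.Perm (Fin k)) (α : Fin k → Option (Fin n)), c (α ∘ σ) = c α)
    (d d' : Fin k → Fin n → A) (hd : ∀ i, SqZero (d i)) (hd' : ∀ i, SqZero (d' i))
    (hsum : ∑ i, d i = ∑ i, d' i) :
    ∑ α, c α * ∏ i, withOne (d i) (α i) = ∑ α, c α * ∏ i, withOne (d' i) (α i) := by
  classical
  have hfac : ∀ α β : Fin k → Option (Fin n), choiceExponent α = choiceExponent β →
      c α = c β := by
    intro α β h
    obtain ⟨σ, rfl⟩ := exists_perm_of_choiceExponent_eq h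
    exact hc σ β
  -- By symmetry the coefficient depends only on the monomial. Monomials that no choice produces get
  -- the irrelevant value 0.
  let c' : (Fin n →₀ ℕ) → A := Function.extend choiceExponent c 0
  have hc' : ∀ α, c' (choiceExponent α) = c α := fun α =>
    Function.FactorsThrough.extend_apply (fun a b h => hfac a b h) _ α
  let ℓ : MvPolynomial (Fin n) A →ₗ[A] A := (MvPolynomial.basisMonomials (Fin n) A).constr A c'
  have hℓ : ∀ m, ℓ (MvPolynomial.monomial m 1) = c' m := by
    intro m
    have := (MvPolynomial.basisMonomials (Fin n) A).constr_basis A c' m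
    simpa using this
  have key : ∀ e : Fin k → Fin n → A,
      ∑ α, c α * ∏ i, withOne (e i) (α i) = ℓ (∏ i, (1 + genPoly (e i))) := by
    intro e
    simp only [one_add_genPoly]
    rw [Finset.prod_univ_sum, map_sum]
    simp only [Fintype.piFinset_univ]
    refine Finset.sum_congr rfl fun α _ => ?_
    rw [Finset.prod_mul_distrib, prod_withOne_X, ← map_prod, ← MvPolynomial.smul_eq_C_mul,
      map_smul, hℓ, hc', smul_eq_mul, mul_comm]
  rw [key, key, (prod_one_add_genPoly Finset.univ d hd).2,
    (prod_one_add_genPoly Finset.univ d' hd').2, hsum]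

end Symmetric

/-! ### Consequences of the Kock–Lawvere axiom for D(n) and its powers -/

section KockLawvere

variable {C : Type u} [Category.{v} C]

theorem res_res (X : Cᵒᵖ ⥤ Type w') {a b c : C} (h : a ⟶ b) (g : b ⟶ c) (x : X.obj (op c)) :
    res X h (res X g x) = res X (h ≫ g) x := by
  simp [res]

theorem res_id (X : Cᵒᵖ ⥤ Type w') {c : C} (x : X.obj (op c)) : res X (𝟙 c) x = x := by
  simp [res]

variable {R : Cᵒᵖ ⥤ CommAlgCat.{w} ℚ}

theorem resR_resR {a b c : C} (h : a ⟶ b) (g : b ⟶ c) (x : R.obj (op c)) :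
    resR R h (resR R g x) = resR R (h ≫ g) x := by
  simp [resR]

theorem resR_id {c : C} (x : R.obj (op c)) : resR R (𝟙 c) x = x := by
  simp [resR]

variable (R) in
/-- Restriction of a family of generalized scalars. -/
def resV {ι : Type*} {b c : C} (g : b ⟶ c) (d : ι → R.obj (op c)) : ι → R.obj (op b) :=
  fun i => resR R g (d i)

@[simp] theorem resV_apply {ι : Type*} {b c : C} (g : b ⟶ c) (d : ι → R.obj (op c)) (i : ι) :
    resV R g d i = resR R g (d i) := rfl

theorem resV_resV {ι : Type*} {a b c : C} (h : a ⟶ b) (g : b ⟶ c) (x : ι → R.obj (op c)) :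
    resV R h (resV R g x) = resV R (h ≫ g) x :=
  funext fun i => resR_resR h g (x i)

theorem resV_id {ι : Type*} {c : C} (x : ι → R.obj (op c)) : resV R (𝟙 c) x = x :=
  funext fun i => resR_id (x i)

theorem resV_add {ι : Type*} {b c : C} (g : b ⟶ c) (x y : ι → R.obj (op c)) :
    resV R g (x + y) = resV R g x + resV R g y :=
  funext fun i => by simp

theorem resV_zero {ι : Type*} {b c : C} (g : b ⟶ c) :
    resV R g (0 : ι → R.obj (op c)) = 0 :=
  funext fun i => by simp

theorem SqZero.resV {ι : Type*} {b c : C} {d : ι → R.obj (op c)} (hd : SqZero d) (g : b ⟶ c) :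
    SqZero (resV R g d) := fun i j => by
  rw [resV_apply, resV_apply, ← map_mul, hd i j, map_zero]

/-- The Weil algebra of functions on `D(n)`. -/
abbrev DualAlg (n : ℕ) := TrivSqZeroExt ℚ (Fin n → ℚ)

/-- The coordinate functions on `D(n)`, together with the constant function `1`. -/
noncomputable def dualGen {n : ℕ} (o : Option (Fin n)) : DualAlg n :=
  o.elim 1 fun j => TrivSqZeroExt.inr (Pi.single j 1)

theorem isWeilAlgebra_dualAlg (n : ℕ) : IsWeilAlgebra (DualAlg n) := by
  refine ⟨inferInstanceAs (Module.Finite ℚ (ℚ × (Fin n → ℚ))), TrivSqZeroExt.fstHom ℚ ℚ _, 2, ?_⟩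
  rw [sq, Submodule.zero_eq_bot, eq_bot_iff, Ideal.mul_le]
  intro x hx y hy
  have hx' : x.fst = 0 := hx
  have hy' : y.fst = 0 := hy
  rw [Ideal.mem_bot]
  ext <;> simp [hx', hy']

/-- The point of `Spec` of the dual algebra given by a first order infinitesimal vector. -/
noncomputable def dualPoint {n : ℕ} {A : Type*} [CommRing A] [Algebra ℚ A] (d : Fin n → A)
    (hd : SqZero d) : DualAlg n →ₐ[ℚ] A :=
  TrivSqZeroExt.liftEquivOfComm ⟨Fintype.linearCombination ℚ d, fun x y => by
    rw [Fintype.linearCombination_apply, Fintype.linearCombination_apply, Finset.sum_mul_sum]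
    refine Finset.sum_eq_zero fun i _ => Finset.sum_eq_zero fun j _ => ?_
    rw [smul_mul_smul_comm, hd i j, smul_zero]⟩

theorem dualPoint_dualGen {n : ℕ} {A : Type*} [CommRing A] [Algebra ℚ A] (d : Fin n → A)
    (hd : SqZero d) (o : Option (Fin n)) : dualPoint d hd (dualGen o) = withOne d o := by
  cases o with
  | none => exact map_one _
  | some j => simp [dualPoint, dualGen, Fintype.linearCombination_apply]

/-- The coefficient is `x.fst` at `none` and `x.snd j` at `some j`, since one of the two factors is
always 1. -/
theorem dualAlg_eq_sum {n : ℕ} (x : DualAlg n) :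
    x = ∑ o, (withOne (x.snd) o * o.elim x.fst 1) • dualGen o := by
  rw [Fintype.sum_option]
  ext j
  · simp [dualGen, TrivSqZeroExt.fst_sum]
  · simp [dualGen, TrivSqZeroExt.snd_sum, Finset.sum_apply, Pi.single_apply]

theorem sqZero_dualGen {n : ℕ} {A : Type*} [CommRing A] [Algebra ℚ A]
    (s : DualAlg n →ₐ[ℚ] A) : SqZero fun j : Fin n => s (dualGen (some j)) := fun i j => by
  rw [← map_mul]
  simp [dualGen]

/-- D(n) is the spectrum of the Weil algebra `DualAlg n`, so the function comes from an element of R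
⊗ `DualAlg n`. Expanding that element in the basis 1, X₁, …, Xₙ gives the coefficients. -/
theorem exists_affine (hKL : KockLawvere R) {c : C} {n : ℕ}
    (f : ∀ ⦃b : C⦄, (b ⟶ c) → (Fin n → R.obj (op b)) → R.obj (op b))
    (hf : ∀ ⦃a b : C⦄ (h : a ⟶ b) (g : b ⟶ c) (d : Fin n → R.obj (op b)), SqZero d →
      f (h ≫ g) (resV R h d) = resR R h (f g d)) :
    ∃ u : Option (Fin n) → R.obj (op c), ∀ ⦃b : C⦄ (g : b ⟶ c) (d : Fin n → R.obj (op b)),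
      SqZero d → f g d = ∑ o, resR R g (u o) * withOne d o := by
  obtain ⟨t, ht, -⟩ := hKL (DualAlg n) (isWeilAlgebra_dualAlg n) c
    (fun b g s => f g fun j => s (dualGen (some j)))
    (fun a b h g s => hf h g _ (sqZero_dualGen s))
  have hpt : ∀ t : R.obj (op c) ⊗[ℚ] DualAlg n, ∃ u : Option (Fin n) → R.obj (op c),
      ∀ ⦃b : C⦄ (g : b ⟶ c) (s : DualAlg n →ₐ[ℚ] R.obj (op b)),
        Algebra.TensorProduct.productMap (resR R g) s t =
          ∑ o, resR R g (u o) * s (dualGen o) := by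
    intro t
    induction t using TensorProduct.induction_on with
    | zero => exact ⟨0, fun b g s => by simp⟩
    | tmul r x =>
      refine ⟨fun o => (withOne (x.snd) o * o.elim x.fst 1) • r, fun b g s => ?_⟩
      rw [Algebra.TensorProduct.productMap_apply_tmul]
      conv_lhs => rw [dualAlg_eq_sum x]
      rw [map_sum, Finset.mul_sum]
      refine Finset.sum_congr rfl fun o _ => ?_
      rw [map_smul, map_smul, mul_smul_comm, smul_mul_assoc]
    | add x y hx hy =>
      obtain ⟨u, hu⟩ := hx
      obtain ⟨u', hu'⟩ := hy
      refine ⟨u + u', fun b g s => ?_⟩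
      simp [hu, hu', add_mul, Finset.sum_add_distrib]
  obtain ⟨u, hu⟩ := hpt t
  refine ⟨u, fun b g d hd => ?_⟩
  have h1 := ht g (dualPoint d hd)
  simp only [dualPoint_dualGen, withOne_some] at h1
  rw [h1, hu]
  simp only [dualPoint_dualGen]

/-- Both coefficient families define tensors inducing the same function, so the tensors agree by the
uniqueness half of Kock–Lawvere. The dual basis `coord` reads off the coefficients. -/
theorem affine_unique (hKL : KockLawvere R) {c : C} {n : ℕ} {u u' : Option (Fin n) → R.obj (op c)}
    (h : ∀ ⦃b : C⦄ (g : b ⟶ c) (d : Fin n → R.obj (op b)), SqZero d →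
      ∑ o, resR R g (u o) * withOne d o = ∑ o, resR R g (u' o) * withOne d o) : u = u' := by
  have hs : ∀ ⦃b : C⦄ (s : DualAlg n →ₐ[ℚ] R.obj (op b)) (o : Option (Fin n)),
      withOne (fun j => s (dualGen (some j))) o = s (dualGen o) := by
    rintro b s (_ | j)
    · exact (map_one s).symm
    · rfl
  obtain ⟨t, -, huniq⟩ := hKL (DualAlg n) (isWeilAlgebra_dualAlg n) c
    (fun b g s => ∑ o, resR R g (u o) * s (dualGen o))
    (fun a b h g s => by
      simp only [AlgHom.comp_apply, map_sum, map_mul, resR_resR])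
  have key : ∀ u₁ : Option (Fin n) → R.obj (op c), (∀ ⦃b : C⦄ (g : b ⟶ c)
      (s : DualAlg n →ₐ[ℚ] R.obj (op b)),
      ∑ o, resR R g (u o) * s (dualGen o) = ∑ o, resR R g (u₁ o) * s (dualGen o)) →
      ∑ o, u₁ o ⊗ₜ[ℚ] dualGen o = t := by
    intro u₁ h₁
    refine huniq _ fun b g s => ?_
    simp only [h₁, map_sum, Algebra.TensorProduct.productMap_apply_tmul]
  have h1 := key u fun _ _ _ => rfl
  have h2 := key u' fun b g s => by
    have := h g _ (sqZero_dualGen s)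
    simpa only [hs] using this
  have h3 := h1.trans h2.symm
  let coord : Option (Fin n) → DualAlg n →ₗ[ℚ] ℚ := fun o =>
    o.elim (TrivSqZeroExt.fstHom ℚ ℚ (Fin n → ℚ)).toLinearMap
      fun j => (LinearMap.proj j).comp (TrivSqZeroExt.sndHom ℚ (Fin n → ℚ))
  have hcoord : ∀ o o', coord o (dualGen o') = if o' = o then 1 else 0 := by
    rintro (_ | j) (_ | l) <;> simp [coord, dualGen, Pi.single_apply, eq_comm]
  funext o
  have h4 := congrArg (fun x => TensorProduct.rid ℚ _ (LinearMap.lTensor _ (coord o) x)) h3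
  simpa [hcoord, -Fintype.sum_option] using h4

/-- A scalar is zero if its products with all scalars of square zero are. -/
theorem eq_zero_of_mul_sqZero (hKL : KockLawvere R) {c : C} (r : R.obj (op c))
    (h : ∀ ⦃b : C⦄ (g : b ⟶ c) (e : R.obj (op b)), e * e = 0 → resR R g r * e = 0) : r = 0 := by
  have := affine_unique hKL (n := 1) (c := c) (u := fun o => o.elim 0 fun _ => r) (u' := 0)
    (fun b g d hd => by simpa [Fintype.sum_option] using h g (d 0) (hd 0 0))
  exact congrFun this (some 0)

/-- A natural function on `D(n)ᵏ` is multi-affine. -/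
theorem exists_multiaffine (hKL : KockLawvere R) {n : ℕ} (k : ℕ) {c : C}
    (f : ∀ ⦃b : C⦄, (b ⟶ c) → (Fin k → Fin n → R.obj (op b)) → R.obj (op b))
    (hf : ∀ ⦃a b : C⦄ (h : a ⟶ b) (g : b ⟶ c) (d : Fin k → Fin n → R.obj (op b)),
      (∀ i, SqZero (d i)) → f (h ≫ g) (fun i => resV R h (d i)) = resR R h (f g d)) :
    ∃ u : (Fin k → Option (Fin n)) → R.obj (op c), ∀ ⦃b : C⦄ (g : b ⟶ c)
      (d : Fin k → Fin n → R.obj (op b)), (∀ i, SqZero (d i)) →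
      f g d = ∑ α, resR R g (u α) * ∏ i, withOne (d i) (α i) := by
  induction k with
  | zero =>
    refine ⟨fun _ => f (𝟙 c) Fin.elim0, fun b g d hd => ?_⟩
    have := hf g (𝟙 c) Fin.elim0 (fun i => i.elim0)
    rw [Category.comp_id] at this
    simp [← this, Subsingleton.elim d fun i => resV R g (Fin.elim0 i)]
  | succ k ih =>
    have hcons : ∀ {a b : C} (h : a ⟶ b) (e : Fin n → R.obj (op b))
        (d : Fin k → Fin n → R.obj (op b)),
        (fun i => resV R h (Fin.cons (α := fun _ => Fin n → R.obj (op b)) e d i)) =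
          Fin.cons (α := fun _ => Fin n → R.obj (op a)) (resV R h e) fun i => resV R h (d i) := by
      intro a b h e d
      funext i
      refine Fin.cases ?_ (fun i => ?_) i <;> simp
    have hsq : ∀ {b : C} {e : Fin n → R.obj (op b)} {d : Fin k → Fin n → R.obj (op b)},
        SqZero e → (∀ i, SqZero (d i)) →
        ∀ i, SqZero (Fin.cons (α := fun _ => Fin n → R.obj (op b)) e d i) := by
      intro b e d he hd i
      refine Fin.cases ?_ (fun i => ?_) i
      · simpa using he
      · simpa using hd i
    -- Freeze all arguments but the first: the function is affine in that one, with coefficients `U`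
    -- that are natural functions of the others, to which induction applies. Off the square-zero
    -- vectors the value 0 only serves to make `U` total; the same device recurs below before each
    -- `choose`.
    have hex : ∀ ⦃b : C⦄ (g : b ⟶ c) (d : Fin k → Fin n → R.obj (op b)),
        ∃ u : Option (Fin n) → R.obj (op b), (∀ i, SqZero (d i)) →
          ∀ ⦃a : C⦄ (h : a ⟶ b) (e : Fin n → R.obj (op a)), SqZero e →
            f (h ≫ g) (Fin.cons (α := fun _ => Fin n → R.obj (op a)) e fun i => resV R h (d i)) =
              ∑ o, resR R h (u o) * withOne e o := by
      intro b g d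
      by_cases hd : ∀ i, SqZero (d i)
      · obtain ⟨u, hu⟩ := exists_affine hKL (c := b) (n := n)
          (fun a h e => f (h ≫ g)
            (Fin.cons (α := fun _ => Fin n → R.obj (op a)) e fun i => resV R h (d i)))
          (fun a' a l h e he => by
            have := hf l (h ≫ g) _ (hsq he fun i => (hd i).resV h)
            rw [hcons] at this
            simp only [resV_resV] at this
            rw [Category.assoc, this])
        exact ⟨u, fun _ => hu⟩
      · exact ⟨0, fun h => absurd h hd⟩
    choose U hU using hex
    have hnat : ∀ o ⦃a b : C⦄ (h : a ⟶ b) (g : b ⟶ c) (d : Fin k → Fin n → R.obj (op b)),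
        (∀ i, SqZero (d i)) → U (h ≫ g) (fun i => resV R h (d i)) o = resR R h (U g d o) := by
      intro o a b h g d hd
      refine congrFun (affine_unique hKL (u := U (h ≫ g) (fun i => resV R h (d i)))
        (u' := fun o => resR R h (U g d o)) fun a' l e he => ?_) o
      rw [← hU (h ≫ g) _ (fun i => (hd i).resV h) l e he]
      simp only [resV_resV, resR_resR]
      rw [← hU g d hd (l ≫ h) e he, Category.assoc]
    choose V hV using fun o => ih (fun b g d => U g d o) (hnat o)
    refine ⟨fun α => V (α 0) (Fin.tail α), fun b g d hd => ?_⟩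
    have h1 := hU g (Fin.tail d) (fun i => hd _) (𝟙 b) (d 0) (hd 0)
    simp only [resV_id, Category.id_comp, resR_id, Fin.cons_self_tail] at h1
    rw [h1, ← (Fin.consEquiv fun _ => Option (Fin n)).sum_comp, Fintype.sum_prod_type]
    refine Finset.sum_congr rfl fun o _ => ?_
    rw [hV o g (Fin.tail d) (fun i => hd _), Finset.sum_mul]
    refine Finset.sum_congr rfl fun α _ => ?_
    simp [Fin.consEquiv, Fin.prod_univ_succ, Fin.tail]
    ring

/-- For a fixed first argument, the remaining coefficients agree by induction. These are affine in
the first argument, so `affine_unique` finishes. -/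
theorem multiaffine_unique (hKL : KockLawvere R) {n : ℕ} (k : ℕ) {c : C}
    {u u' : (Fin k → Option (Fin n)) → R.obj (op c)}
    (h : ∀ ⦃b : C⦄ (g : b ⟶ c) (d : Fin k → Fin n → R.obj (op b)), (∀ i, SqZero (d i)) →
      ∑ α, resR R g (u α) * ∏ i, withOne (d i) (α i) =
        ∑ α, resR R g (u' α) * ∏ i, withOne (d i) (α i)) : u = u' := by
  induction k generalizing c with
  | zero =>
    funext α
    have := h (𝟙 c) Fin.elim0 (fun i => i.elim0)
    simp only [Fintype.sum_unique, Finset.univ_eq_empty, Finset.prod_empty, mul_one, resR_id] at this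
    convert this
  | succ k ih =>
    have split : ∀ ⦃b : C⦄ (g : b ⟶ c) (d : Fin (k + 1) → Fin n → R.obj (op b))
        (u : (Fin (k + 1) → Option (Fin n)) → R.obj (op c)),
        ∑ α, resR R g (u α) * ∏ i, withOne (d i) (α i) =
          ∑ α : Fin k → Option (Fin n), (∑ o, resR R g
            (u (Fin.cons (α := fun _ => Option (Fin n)) o α)) * withOne (d 0) o) *
              ∏ i, withOne (d i.succ) (α i) := by
      intro b g d u
      rw [← (Fin.consEquiv fun _ => Option (Fin n)).sum_comp, Fintype.sum_prod_type,
        Finset.sum_comm]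
      refine Finset.sum_congr rfl fun α _ => ?_
      rw [Finset.sum_mul]
      refine Finset.sum_congr rfl fun o _ => ?_
      simp [Fin.consEquiv, Fin.prod_univ_succ]
      ring
    have key : ∀ ⦃b : C⦄ (g : b ⟶ c) (e : Fin n → R.obj (op b)), SqZero e →
        (fun α : Fin k → Option (Fin n) => ∑ o, resR R g
          (u (Fin.cons (α := fun _ => Option (Fin n)) o α)) * withOne e o) =
        (fun α : Fin k → Option (Fin n) => ∑ o, resR R g
          (u' (Fin.cons (α := fun _ => Option (Fin n)) o α)) * withOne e o) := by
      intro b g e he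
      refine ih fun a l d hd => ?_
      have h1 := h (l ≫ g) (Fin.cons (α := fun _ => Fin n → R.obj (op a)) (resV R l e) d)
        (fun i => Fin.cases (by simpa using he.resV l) (fun i => by simpa using hd i) i)
      rw [split, split] at h1
      have hw : ∀ o, resR R l (withOne e o) = withOne (resV R l e) o := by
        rintro (_ | j) <;> simp
      simpa [map_sum, resR_resR, hw] using h1
    funext α
    have := affine_unique hKL (u := fun o => u (Fin.cons (α := fun _ => Option (Fin n)) o
      (Fin.tail α))) (u' := fun o => u' (Fin.cons (α := fun _ => Option (Fin n)) o (Fin.tail α)))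
      (fun b g e he => congrFun (key g e he) (Fin.tail α))
    have := congrFun this (α 0)
    simpa using this

/-- A symmetric natural function on `D(n)ᵏ` only depends on the sum of its arguments. -/
theorem symmetric_eq_of_sum_eq (hKL : KockLawvere R) {n k : ℕ} {c : C}
    (f : ∀ ⦃b : C⦄, (b ⟶ c) → (Fin k → Fin n → R.obj (op b)) → R.obj (op b))
    (hf : ∀ ⦃a b : C⦄ (h : a ⟶ b) (g : b ⟶ c) (d : Fin k → Fin n → R.obj (op b)),
      (∀ i, SqZero (d i)) → f (h ≫ g) (fun i => resV R h (d i)) = resR R h (f g d))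
    (hsymm : ∀ ⦃b : C⦄ (g : b ⟶ c) (d : Fin k → Fin n → R.obj (op b)), (∀ i, SqZero (d i)) →
      ∀ σ : Equiv.Perm (Fin k), f g (d ∘ σ) = f g d)
    (d d' : Fin k → Fin n → R.obj (op c)) (hd : ∀ i, SqZero (d i)) (hd' : ∀ i, SqZero (d' i))
    (hsum : ∑ i, d i = ∑ i, d' i) : f (𝟙 c) d = f (𝟙 c) d' := by
  obtain ⟨u, hu⟩ := exists_multiaffine hKL k f hf
  rw [hu _ d hd, hu _ d' hd']
  simp only [resR_id]
  refine symmetric_multiaffine_eq u (fun σ α => ?_) d d' hd hd' hsum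
  -- Permuting the arguments permutes the coefficients, so symmetry of the function becomes symmetry
  -- of `u` by uniqueness of the coefficients.
  refine congrFun (multiaffine_unique hKL k (u := fun α => u (α ∘ σ)) (u' := u)
    fun b g e he => ?_) α
  rw [← hu g e he, ← hsymm g e he σ, hu g (e ∘ σ) (fun i => he _),
    ← (Equiv.arrowCongr σ (Equiv.refl (Option (Fin n)))).sum_comp]
  refine Finset.sum_congr rfl fun β _ => ?_
  congr 1
  · congr 2
    funext i
    simp [Equiv.arrowCongr]
  · rw [← Equiv.prod_comp σ]
    simp [Equiv.arrowCongr]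

end KockLawvere

/-! ### Order-independent processes driven by infinitesimal steps -/

section Fold

variable {C : Type u} [Category.{v} C] {R : Cᵒᵖ ⥤ CommAlgCat.{w} ℚ}

/-- A system which is moved by first order infinitesimal vectors, naturally in the stage, and such
that the order of two successive moves is irrelevant. -/
structure CommutingSteps (R : Cᵒᵖ ⥤ CommAlgCat.{w} ℚ) (n : ℕ) (c : C) where
  State : C → Type w
  restr : ∀ ⦃a b : C⦄, (a ⟶ b) → State b → State a
  Valid : ∀ ⦃b : C⦄, (b ⟶ c) → State b → Prop
  step : ∀ ⦃b : C⦄, (b ⟶ c) → State b → (Fin n → R.obj (op b)) → State b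
  init : ∀ ⦃b : C⦄, (b ⟶ c) → State b
  valid_init : ∀ ⦃b : C⦄ (g : b ⟶ c), Valid g (init g)
  restr_init : ∀ ⦃a b : C⦄ (h : a ⟶ b) (g : b ⟶ c), restr h (init g) = init (h ≫ g)
  valid_step : ∀ ⦃b : C⦄ (g : b ⟶ c) (s : State b) (d : Fin n → R.obj (op b)),
    Valid g s → SqZero d → Valid g (step g s d)
  restr_step : ∀ ⦃a b : C⦄ (h : a ⟶ b) (g : b ⟶ c) (s : State b) (d : Fin n → R.obj (op b)),
    Valid g s → SqZero d → restr h (step g s d) = step (h ≫ g) (restr h s) (resV R h d)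
  step_zero : ∀ ⦃b : C⦄ (g : b ⟶ c) (s : State b), Valid g s → step g s 0 = s
  step_comm : ∀ ⦃b : C⦄ (g : b ⟶ c) (s : State b) (d e : Fin n → R.obj (op b)),
    Valid g s → SqZero d → SqZero e → step g (step g s d) e = step g (step g s e) d

namespace CommutingSteps

variable {n : ℕ} {c : C} (T : CommutingSteps R n c)

/-- Move along a list of vectors. -/
def run {b : C} (g : b ⟶ c) (s : T.State b) (l : List (Fin n → R.obj (op b))) : T.State b :=
  l.foldl (T.step g) s

theorem run_append_singleton {b : C} (g : b ⟶ c) (s : T.State b)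
    (l : List (Fin n → R.obj (op b))) (d : Fin n → R.obj (op b)) :
    T.run g s (l ++ [d]) = T.step g (T.run g s l) d := by
  simp [run]

theorem valid_run {b : C} (g : b ⟶ c) (l : List (Fin n → R.obj (op b))) :
    ∀ s : T.State b, T.Valid g s → (∀ d ∈ l, SqZero d) → T.Valid g (T.run g s l) := by
  induction l with
  | nil => exact fun s hs _ => hs
  | cons d l ih =>
    exact fun s hs hl => ih _ (T.valid_step g s d hs (hl d (by simp)))
      fun e he => hl e (by simp [he])

theorem restr_run {a b : C} (h : a ⟶ b) (g : b ⟶ c) (l : List (Fin n → R.obj (op b))) :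
    ∀ s : T.State b, T.Valid g s → (∀ d ∈ l, SqZero d) →
      T.restr h (T.run g s l) = T.run (h ≫ g) (T.restr h s) (l.map (resV R h)) := by
  induction l with
  | nil => exact fun s hs _ => rfl
  | cons d l ih =>
    intro s hs hl
    have hd := hl d (by simp)
    have := ih _ (T.valid_step g s d hs hd) fun e he => hl e (by simp [he])
    rw [T.restr_step h g s d hs hd] at this
    exact this

theorem run_perm {b : C} (g : b ⟶ c) {l l' : List (Fin n → R.obj (op b))} (hp : l.Perm l') :
    ∀ s : T.State b, T.Valid g s → (∀ d ∈ l, SqZero d) → T.run g s l = T.run g s l' := by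
  induction hp with
  | nil => exact fun _ _ _ => rfl
  | cons d _ ih =>
    exact fun s hs hl => ih _ (T.valid_step g s d hs (hl d (by simp)))
      fun e he => hl e (by simp [he])
  | swap d e l =>
    intro s hs hl
    exact congrArg (fun t => T.run g t l)
      (T.step_comm g s e d hs (hl e (by simp)) (hl d (by simp)))
  | trans hp _ ih ih' =>
    exact fun s hs hl => (ih s hs hl).trans (ih' s hs fun d hd => hl d (hp.mem_iff.2 hd))

theorem run_append_zeros {b : C} (g : b ⟶ c) (l : List (Fin n → R.obj (op b))) (m : ℕ)
    (s : T.State b) (hs : T.Valid g s) (hl : ∀ d ∈ l, SqZero d) :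
    T.run g s (l ++ List.replicate m 0) = T.run g s l := by
  induction m with
  | zero => simp
  | succ m ih =>
    rw [List.replicate_succ', ← List.append_assoc, run_append_singleton, ih,
      T.step_zero g _ (T.valid_run g l s hs hl)]

/-- The values of natural observables after moving along a list of vectors only depend on the sum
of these vectors. -/
theorem observe_eq (hKL : KockLawvere R) (obs : ∀ ⦃b : C⦄, T.State b → R.obj (op b))
    (hobs : ∀ ⦃a b : C⦄ (h : a ⟶ b) (s : T.State b), obs (T.restr h s) = resR R h (obs s))
    {l l' : List (Fin n → R.obj (op c))} (hl : ∀ d ∈ l, SqZero d) (hl' : ∀ d ∈ l', SqZero d)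
    (hsum : l.sum = l'.sum) :
    obs (T.run (𝟙 c) (T.init (𝟙 c)) l) = obs (T.run (𝟙 c) (T.init (𝟙 c)) l') := by
  have key : ∀ (k : ℕ) (d d' : Fin k → Fin n → R.obj (op c)), (∀ i, SqZero (d i)) →
      (∀ i, SqZero (d' i)) → ∑ i, d i = ∑ i, d' i →
      obs (T.run (𝟙 c) (T.init (𝟙 c)) (List.ofFn d)) =
        obs (T.run (𝟙 c) (T.init (𝟙 c)) (List.ofFn d')) := by
    intro k d d' hd hd' hs
    refine symmetric_eq_of_sum_eq hKL
      (fun b g d => obs (T.run g (T.init g) (List.ofFn d))) ?_ ?_ d d' hd hd' hs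
    · intro a b h g d hd
      rw [← hobs, T.restr_run h g _ _ (T.valid_init g) (by simpa [List.mem_ofFn] using hd),
        T.restr_init, List.map_ofFn]
      rfl
    · intro b g d hd σ
      refine congrArg (fun t => obs t) (T.run_perm g (σ.ofFn_comp_perm d) _ (T.valid_init g) ?_)
      simpa [List.mem_ofFn] using fun i => hd (σ i)
  have key' : ∀ l l' : List (Fin n → R.obj (op c)), (∀ d ∈ l, SqZero d) →
      (∀ d ∈ l', SqZero d) → l.length = l'.length → l.sum = l'.sum →
      obs (T.run (𝟙 c) (T.init (𝟙 c)) l) = obs (T.run (𝟙 c) (T.init (𝟙 c)) l') := by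
    intro l l' hl hl' hlen hs
    obtain ⟨k, d, rfl⟩ : ∃ (k : ℕ) (d : Fin k → Fin n → R.obj (op c)), l = List.ofFn d :=
      ⟨_, l.get, (List.ofFn_get l).symm⟩
    obtain ⟨d', rfl⟩ : ∃ d' : Fin k → Fin n → R.obj (op c), l' = List.ofFn d' := by
      rw [List.length_ofFn] at hlen
      subst hlen
      exact ⟨l'.get, (List.ofFn_get l').symm⟩
    refine key k d d' (by simpa [List.mem_ofFn] using hl) (by simpa [List.mem_ofFn] using hl') ?_
    simpa [List.sum_ofFn] using hs
  -- Zero steps do nothing, so each list is padded by the length of the other. Both runs then are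
  -- values of one function on the same power of D(n).
  rw [← T.run_append_zeros (𝟙 c) l l'.length _ (T.valid_init _) hl,
    ← T.run_append_zeros (𝟙 c) l' l.length _ (T.valid_init _) hl']
  refine key' _ _ ?_ ?_ (by simp [add_comm]) (by simpa using hsum)
  · simp only [List.mem_append, List.mem_replicate]
    rintro d (h | ⟨-, rfl⟩)
    exacts [hl d h, SqZero.zero]
  · simp only [List.mem_append, List.mem_replicate]
    rintro d (h | ⟨-, rfl⟩)
    exacts [hl' d h, SqZero.zero]

end CommutingSteps

end Fold

/-! ### Neighbours in charts -/

section Charts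

variable {C : Type u} [Category.{v} C] {J : GrothendieckTopology C}
  {R : Cᵒᵖ ⥤ CommAlgCat.{w} ℚ} {M : Cᵒᵖ ⥤ Type w'}

theorem eq_of_locally_eq {X : Cᵒᵖ ⥤ Type w'} (hX : Presieve.IsSheaf J X) {c : C}
    {x y : X.obj (op c)} {S : Sieve c} (hS : S ∈ J c)
    (h : ∀ ⦃b : C⦄ (g : b ⟶ c), S g → res X g x = res X g y) : x = y :=
  (hX S hS).isSeparatedFor.ext fun _ g hg => h g hg

theorem scalar_eq_of_locally_eq (hR : Presieve.IsSheaf J (R ⋙ forget (CommAlgCat ℚ))) {c : C}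
    {x y : R.obj (op c)} {S : Sieve c} (hS : S ∈ J c)
    (h : ∀ ⦃b : C⦄ (g : b ⟶ c), S g → resR R g x = resR R g y) : x = y :=
  (hR S hS).isSeparatedFor.ext fun _ g hg => h g hg

theorem Nbr.of_locally {X : Cᵒᵖ ⥤ Type w'} {c : C} {x y : X.obj (op c)} {S : Sieve c}
    (hS : S ∈ J c) (h : ∀ ⦃b : C⦄ (g : b ⟶ c), S g → Nbr J R X (res X g x) (res X g y)) :
    Nbr J R X x y := by
  choose T hT H using h
  refine ⟨Sieve.bind S fun b g hg => T g hg, J.bind_covering hS fun b g hg => hT g hg, ?_⟩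
  rintro a _ ⟨b, h, g, hg, hh, rfl⟩
  obtain ⟨m, f, o, d, ho, h0, h1⟩ := H g hg h hh
  exact ⟨m, f, o, d, ho, by rw [h0, res_res], by rw [h1, res_res]⟩

/-- A figure restricted along a map of stages. -/
def Figure.restrict {X : Cᵒᵖ ⥤ Type w'} {m : ℕ} {b c : C} (f : Figure R X m c) (g : b ⟶ c) :
    Figure R X m b where
  toFun _ h d := f.toFun (h ≫ g) d
  natural a b h g' d d' hd := by
    rw [Category.assoc]
    exact f.natural h (g' ≫ g) d d' hd

/-- Restriction of a point of `D(m)`. -/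
def restrictInf {m : ℕ} {b c : C} (d : {d : Fin m → R.obj (op c) // CoordNbr 0 d}) (g : b ⟶ c) :
    {d : Fin m → R.obj (op b) // CoordNbr 0 d} :=
  ⟨resV R g d.1, coordNbr_zero_iff.2 ((coordNbr_zero_iff.1 d.2).resV g)⟩

theorem Figure.nbr {X : Cᵒᵖ ⥤ Type w'} {m : ℕ} {b c : C} (f : Figure R X m c) (g : b ⟶ c)
    (o d : {d : Fin m → R.obj (op b) // CoordNbr 0 d}) (ho : o.1 = 0) :
    Nbr J R X (f.toFun g o) (f.toFun g d) := by
  refine ⟨⊤, J.top_mem b, fun a h _ => ⟨m, f.restrict (h ≫ g),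
    restrictInf o h, restrictInf d h, ?_, ?_, ?_⟩⟩
  · exact (congrArg (resV R h) ho).trans (resV_zero h)
  · rw [← f.natural h g o (restrictInf o h) fun i => rfl]; simp [Figure.restrict]
  · rw [← f.natural h g d (restrictInf d h) fun i => rfl]; simp [Figure.restrict]

namespace Chart

variable {n : ℕ} {c : C} (χ : Chart J R M n c)

/-- The point `x` has coordinates `p` in the chart. -/
def At {b : C} (g : b ⟶ c) (p : Fin n → R.obj (op b)) (x : M.obj (op b)) : Prop :=
  ∃ hp : p ∈ χ.dom g, χ.map g ⟨p, hp⟩ = x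

variable {χ}

theorem exists_at {b : C} {g : b ⟶ c} {p : Fin n → R.obj (op b)} (hp : p ∈ χ.dom g) :
    ∃ x, χ.At g p x := ⟨_, hp, rfl⟩

theorem At.mem {b : C} {g : b ⟶ c} {p : Fin n → R.obj (op b)} {x : M.obj (op b)}
    (h : χ.At g p x) : p ∈ χ.dom g := h.1

theorem At.point_eq {b : C} {g : b ⟶ c} {p : Fin n → R.obj (op b)} {x y : M.obj (op b)}
    (hx : χ.At g p x) (hy : χ.At g p y) : x = y := by
  obtain ⟨_, rfl⟩ := hx
  obtain ⟨_, rfl⟩ := hy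
  rfl

theorem At.coord_eq {b : C} {g : b ⟶ c} {p q : Fin n → R.obj (op b)} {x : M.obj (op b)}
    (hp : χ.At g p x) (hq : χ.At g q x) : p = q := by
  obtain ⟨_, rfl⟩ := hp
  obtain ⟨_, h⟩ := hq
  exact (congrArg Subtype.val (χ.map_injective g h)).symm

theorem At.restrict {a b : C} {g : b ⟶ c} {p : Fin n → R.obj (op b)} {x : M.obj (op b)}
    (hp : χ.At g p x) (h : a ⟶ b) : χ.At (h ≫ g) (resV R h p) (res M h x) := by
  obtain ⟨hp, rfl⟩ := hp
  exact ⟨χ.dom_res h g p hp, χ.map_natural h g ⟨p, hp⟩⟩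

theorem mem_dom_add {b : C} {g : b ⟶ c} {p d : Fin n → R.obj (op b)} (hp : p ∈ χ.dom g)
    (hd : SqZero d) : p + d ∈ χ.dom g :=
  χ.dom_open g p _ hp fun i j => by simpa using hd i j

theorem resV_mem_dom {a b : C} (h : a ⟶ b) {g : b ⟶ c} {p : Fin n → R.obj (op b)}
    (hp : p ∈ χ.dom g) : resV R h p ∈ χ.dom (h ≫ g) :=
  χ.dom_res h g p hp

theorem At.exists_of_nbr {b : C} {g : b ⟶ c} {p : Fin n → R.obj (op b)} {x y : M.obj (op b)}
    (hp : χ.At g p x) (h : Nbr J R M x y) : ∃ q, χ.At g q y := by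
  obtain ⟨hp, hx⟩ := hp
  obtain ⟨⟨q, hq⟩, hy⟩ := χ.range_open g x y ⟨_, hx⟩ h
  exact ⟨q, hq, hy⟩

/-- The map e ↦ χ(p + e) is a figure D(n) ⟶ M, because the domain of the chart is closed under
coordinate neighbours. -/
theorem At.nbr {b : C} {g : b ⟶ c} {p d : Fin n → R.obj (op b)} {x y : M.obj (op b)}
    (hp : χ.At g p x) (hq : χ.At g (p + d) y) (hd : SqZero d) : Nbr J R M x y := by
  have hmem : ∀ ⦃a : C⦄ (h : a ⟶ b) (e : Fin n → R.obj (op a)), CoordNbr 0 e →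
      resV R h p + e ∈ χ.dom (h ≫ g) := fun a h e he =>
    mem_dom_add (resV_mem_dom h hp.mem) (coordNbr_zero_iff.1 he)
  let f : Figure R M n b :=
    { toFun := fun a h e => χ.map (h ≫ g) ⟨resV R h p + e.1, hmem h e.1 e.2⟩
      natural := by
        intro a a' l h d d' hd'
        refine At.point_eq (χ := χ) (g := (l ≫ h) ≫ g) (p := resV R (l ≫ h) p + d'.1)
          ⟨_, rfl⟩ ?_
        have h1 : χ.At (h ≫ g) (resV R h p + d.1) _ := ⟨hmem h d.1 d.2, rfl⟩
        have h2 := h1.restrict l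
        rw [resV_add, resV_resV, ← Category.assoc] at h2
        have h3 : d'.1 = resV R l d.1 := funext hd'
        rwa [h3] }
  have hf : ∀ e : {e : Fin n → R.obj (op b) // CoordNbr 0 e},
      χ.At g (p + e.1) (f.toFun (𝟙 b) e) := by
    intro e
    have : χ.At (𝟙 b ≫ g) (resV R (𝟙 b) p + e.1) (f.toFun (𝟙 b) e) := ⟨hmem _ e.1 e.2, rfl⟩
    rwa [Category.id_comp, resV_id] at this
  have h0 := hf ⟨0, coordNbr_zero_iff.2 SqZero.zero⟩
  have h1 := hf ⟨d, coordNbr_zero_iff.2 hd⟩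
  rw [add_zero] at h0
  rw [hp.point_eq h0, hq.point_eq h1]
  have := f.nbr (J := J) (𝟙 b) ⟨0, coordNbr_zero_iff.2 SqZero.zero⟩
    ⟨d, coordNbr_zero_iff.2 hd⟩ rfl
  exact this

/-- Openness of the chart allows a figure starting at x to be read in coordinates. It is then affine
by Kock–Lawvere, so q - p is linear in d ∈ D(m), and products of its entries involve only the
vanishing d_k d_l. -/
theorem At.sqZero_of_nbr (hR : Presieve.IsSheaf J (R ⋙ forget (CommAlgCat ℚ)))
    (hKL : KockLawvere R) {b : C} {g : b ⟶ c} {p q : Fin n → R.obj (op b)}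
    {x y : M.obj (op b)} (hp : χ.At g p x) (hq : χ.At g q y) (hxy : Nbr J R M x y) :
    SqZero (q - p) := by
  obtain ⟨S, hS, H⟩ := hxy
  intro i j
  refine scalar_eq_of_locally_eq hR hS fun a h hh => ?_
  obtain ⟨m, f, o, d, ho, h0, h1⟩ := H h hh
  have hex : ∀ ⦃a' : C⦄ (l : a' ⟶ a) (e : Fin m → R.obj (op a')),
      ∃ r : Fin n → R.obj (op a'), ∀ he : CoordNbr 0 e,
        χ.At (l ≫ h ≫ g) r (f.toFun l ⟨e, he⟩) := by
    intro a' l e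
    by_cases he : CoordNbr 0 e
    · have hA := (hp.restrict h).restrict l
      rw [← h0, ← f.natural l (𝟙 a) o ⟨0, coordNbr_zero_iff.2 SqZero.zero⟩
        (fun i => by simp [ho]), Category.comp_id] at hA
      obtain ⟨r, hr⟩ := hA.exists_of_nbr (f.nbr l _ ⟨e, he⟩ rfl)
      exact ⟨r, fun _ => hr⟩
    · exact ⟨0, fun h => absurd h he⟩
  choose r hr using hex
  have haff : ∀ i, ∃ u : Option (Fin m) → R.obj (op a), ∀ ⦃a' : C⦄ (l : a' ⟶ a)
      (e : Fin m → R.obj (op a')), SqZero e → r l e i = ∑ o, resR R l (u o) * withOne e o := by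
    intro i
    refine exists_affine hKL (fun a' l e => r l e i) fun a'' a' k l e he => ?_
    have h1 := hr (k ≫ l) (resV R k e) (coordNbr_zero_iff.2 (he.resV k))
    have h2 := (hr l e (coordNbr_zero_iff.2 he)).restrict k
    rw [← f.natural k l ⟨e, _⟩ ⟨resV R k e, coordNbr_zero_iff.2 (he.resV k)⟩ fun i => rfl,
      ← Category.assoc] at h2
    rw [Category.assoc] at h1 h2
    exact congrFun (h1.coord_eq h2) i
  choose u hu using haff
  have hp' := hp.restrict h
  have hq' := hq.restrict h
  rw [← h0] at hp'
  rw [← h1] at hq'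
  have e1 := hr (𝟙 a) o.1 o.2
  have e2 := hr (𝟙 a) d.1 d.2
  rw [Category.id_comp] at e1 e2
  have e3 := e1.coord_eq hp'
  have e4 := e2.coord_eq hq'
  have hsub : ∀ i, resR R h (q i) - resR R h (p i) = ∑ j, u i (some j) * d.1 j := by
    intro i
    have f3 := congrFun e3 i
    have f4 := congrFun e4 i
    rw [hu i _ _ (coordNbr_zero_iff.1 o.2)] at f3
    rw [hu i _ _ (coordNbr_zero_iff.1 d.2)] at f4
    rw [resV_apply] at f3 f4
    rw [← f3, ← f4]
    simp [Fintype.sum_option, ho, resR_id]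
  rw [Pi.sub_apply, Pi.sub_apply, map_mul, map_sub, map_sub, hsub, hsub, map_zero,
    Finset.sum_mul_sum]
  refine Finset.sum_eq_zero fun k _ => Finset.sum_eq_zero fun l _ => ?_
  rw [mul_mul_mul_comm, (coordNbr_zero_iff.1 d.2) k l, mul_zero]

/-- In coordinates the relation concerns only products of two entries of q - p, which do not change
under q - p ↦ p - q. -/
theorem At.nbr_symm (hR : Presieve.IsSheaf J (R ⋙ forget (CommAlgCat ℚ)))
    (hKL : KockLawvere R) {b : C} {g : b ⟶ c} {p : Fin n → R.obj (op b)}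
    {x y : M.obj (op b)} (hp : χ.At g p x) (hxy : Nbr J R M x y) : Nbr J R M y x := by
  obtain ⟨q, hq⟩ := hp.exists_of_nbr hxy
  have hs := hp.sqZero_of_nbr hR hKL hq hxy
  refine hq.nbr (d := p - q) (by rwa [add_sub_cancel]) fun i j => ?_
  have := hs i j
  rw [← neg_sub q p, Pi.neg_apply, Pi.neg_apply, neg_mul_neg, this]

end Chart

theorem IsFormalManifold.nbr_symm (hR : Presieve.IsSheaf J (R ⋙ forget (CommAlgCat ℚ)))
    (hKL : KockLawvere R) (hman : IsFormalManifold J R M) {c : C} {x y : M.obj (op c)}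
    (hxy : Nbr J R M x y) : Nbr J R M y x := by
  obtain ⟨S, hS, H⟩ := hman x
  refine Nbr.of_locally hS fun b g hg => ?_
  obtain ⟨n, χ, ⟨p, hp⟩, hx⟩ := H g hg
  exact Chart.At.nbr_symm hR hKL (χ := χ) (g := 𝟙 b) (p := p) ⟨hp, hx⟩ (hxy.restrict J R g)

end Charts

/-! ### Matrix-valued linear forms and the second-order expansion of transport -/

section LinearForms

variable {A : Type*} [CommRing A] {n : ℕ}

/-- The matrix valued linear form with coefficients `Γ`. -/
def matForm (Γ : Fin n → Matrix (Fin n) (Fin n) A) (d : Fin n → A) : Matrix (Fin n) (Fin n) A :=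
  ∑ i, d i • Γ i

theorem matForm_add (Γ : Fin n → Matrix (Fin n) (Fin n) A) (d e : Fin n → A) :
    matForm Γ (d + e) = matForm Γ d + matForm Γ e := by
  simp [matForm, add_smul, Finset.sum_add_distrib]

theorem matForm_zero (Γ : Fin n → Matrix (Fin n) (Fin n) A) : matForm Γ 0 = 0 := by
  simp [matForm]

theorem matForm_mul_matForm (Γ Γ' : Fin n → Matrix (Fin n) (Fin n) A) (d e : Fin n → A) :
    matForm Γ d * matForm Γ' e = ∑ i, ∑ j, (d i * e j) • (Γ i * Γ' j) := by
  simp only [matForm, Finset.sum_mul_sum, smul_mul_smul_comm]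

theorem matForm_mul_matForm_eq_zero (Γ Γ' : Fin n → Matrix (Fin n) (Fin n) A) {d e : Fin n → A}
    (h : ∀ i j, d i * e j = 0) : matForm Γ d * matForm Γ' e = 0 := by
  simp [matForm_mul_matForm, h]

theorem matForm_mulVec_mul_eq_zero (Γ : Fin n → Matrix (Fin n) (Fin n) A) {d e f : Fin n → A}
    (h : ∀ i j, d i * f j = 0) (i j : Fin n) : (matForm Γ d).mulVec e i * f j = 0 := by
  simp only [matForm, Matrix.sum_mulVec, Finset.sum_apply, Matrix.smul_mulVec, Pi.smul_apply,
    smul_eq_mul, Finset.sum_mul]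
  refine Finset.sum_eq_zero fun k _ => ?_
  rw [mul_right_comm, h, zero_mul]

theorem SqZero.mulVec {d : Fin n → A} (hd : SqZero d) (F : Matrix (Fin n) (Fin n) A) :
    SqZero (F.mulVec d) := fun i j => by
  simp only [Matrix.mulVec, dotProduct, Finset.sum_mul_sum]
  refine Finset.sum_eq_zero fun k _ => Finset.sum_eq_zero fun l _ => ?_
  rw [mul_mul_mul_comm, hd, mul_zero]

theorem matForm_deriv (Γ : Fin n → Matrix (Fin n) (Fin n) A)
    (D : Fin n → Fin n → Matrix (Fin n) (Fin n) A) (d e : Fin n → A) :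
    matForm (fun i => Γ i + ∑ m, d m • D m i) e =
      matForm Γ e + ∑ m, ∑ i, (d m * e i) • D m i := by
  simp only [matForm, smul_add, Finset.sum_add_distrib, Finset.smul_sum, smul_smul]
  rw [Finset.sum_comm (γ := Fin n)]
  simp only [mul_comm]

/-- Transport along d and then along e, with `D` the derivative of `Γ`. The terms quadratic in d
vanish; the part of the last coefficient that is antisymmetric in m and i is the curvature. -/
theorem one_add_matForm_mul (Γ : Fin n → Matrix (Fin n) (Fin n) A)
    (D : Fin n → Fin n → Matrix (Fin n) (Fin n) A) {d e : Fin n → A} (hd : SqZero d) :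
    (1 + matForm (fun i => Γ i + ∑ m, d m • D m i) e) * (1 + matForm Γ d) =
      1 + (matForm Γ d + matForm Γ e) + ∑ m, ∑ i, (d m * e i) • (D m i + Γ i * Γ m) := by
  have h0 : (∑ m, ∑ i, (d m * e i) • D m i) * matForm Γ d = 0 := by
    simp only [matForm, Finset.sum_mul, Finset.mul_sum, smul_mul_smul_comm]
    refine Finset.sum_eq_zero fun i _ => Finset.sum_eq_zero fun j _ =>
      Finset.sum_eq_zero fun k _ => ?_
    rw [mul_right_comm, hd, zero_mul, zero_smul]
  have h1 : matForm Γ e * matForm Γ d = ∑ m, ∑ i, (d m * e i) • (Γ i * Γ m) := by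
    rw [matForm_mul_matForm, Finset.sum_comm]
    simp only [mul_comm]
  rw [matForm_deriv]
  simp only [add_mul, mul_add, one_mul, mul_one, h0, h1, smul_add, Finset.sum_add_distrib]
  abel

theorem sqZero_single_add_single {i j : Fin n} {s t : A} (hs : s * s = 0) (ht : t * t = 0)
    (hst : s * t = 0) : SqZero (Pi.single i s + Pi.single j t : Fin n → A) := by
  intro k l
  have hts : t * s = 0 := by rw [mul_comm, hst]
  simp only [Pi.add_apply, Pi.single_apply, add_mul, mul_add, ite_mul, mul_ite, hs, ht, hst, hts,
    mul_zero, zero_mul, ite_self, add_zero]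

theorem sum_sum_single_smul {E : Type*} [AddCommGroup E] [Module A E] (B : Fin n → Fin n → E)
    (i j : Fin n) (s t s' t' : A) :
    ∑ m, ∑ k, ((Pi.single i s + Pi.single j t : Fin n → A) m *
        (Pi.single i s' + Pi.single j t' : Fin n → A) k) • B m k =
      (s * s') • B i i + (s * t') • B i j + (t * s') • B j i + (t * t') • B j j := by
  simp only [Pi.add_apply, add_mul, mul_add, add_smul, Finset.sum_add_distrib, Pi.single_apply,
    ite_mul, mul_ite, zero_mul, mul_zero, ite_smul, zero_smul, Finset.sum_ite_eq',
    Finset.mem_univ, if_true]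
  abel

end LinearForms

/-! ### Christoffel symbols of a connection -/

section Christoffel

variable {C : Type u} [Category.{v} C] {J : GrothendieckTopology C}
  {R : Cᵒᵖ ⥤ CommAlgCat.{w} ℚ} {M : Cᵒᵖ ⥤ Type w'} {n : ℕ}

variable (R) in
/-- Restriction of matrices of generalized scalars. -/
abbrev resM {b c : C} (g : b ⟶ c) :
    Matrix (Fin n) (Fin n) (R.obj (op c)) →ₐ[ℚ] Matrix (Fin n) (Fin n) (R.obj (op b)) :=
  (resR R g).mapMatrix

theorem resM_smul {b c : C} (g : b ⟶ c) (r : R.obj (op c))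
    (F : Matrix (Fin n) (Fin n) (R.obj (op c))) :
    resM R g (r • F) = resR R g r • resM R g F := by
  ext i j
  simp

theorem resM_resM {a b c : C} (h : a ⟶ b) (g : b ⟶ c)
    (F : Matrix (Fin n) (Fin n) (R.obj (op c))) : resM R h (resM R g F) = resM R (h ≫ g) F := by
  ext i j
  exact resR_resR h g _

theorem resM_id {c : C} (F : Matrix (Fin n) (Fin n) (R.obj (op c))) : resM R (𝟙 c) F = F := by
  ext i j
  exact resR_id _

theorem resV_mulVec {b c : C} (g : b ⟶ c) (F : Matrix (Fin n) (Fin n) (R.obj (op c)))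
    (d : Fin n → R.obj (op c)) : resV R g (F.mulVec d) = (resM R g F).mulVec (resV R g d) :=
  funext fun i => by simp [Matrix.mulVec, dotProduct]

theorem resM_matForm {b c : C} (g : b ⟶ c) (Γ : Fin n → Matrix (Fin n) (Fin n) (R.obj (op c)))
    (d : Fin n → R.obj (op c)) :
    resM R g (matForm Γ d) = matForm (fun i => resM R g (Γ i)) (resV R g d) := by
  simp only [matForm, map_sum, resM_smul, resV_apply]

/-- A matrix is determined by its products with first order infinitesimal vectors. -/
theorem matrix_ext_sqZero (hKL : KockLawvere R) {c : C}
    {F F' : Matrix (Fin n) (Fin n) (R.obj (op c))}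
    (h : ∀ ⦃b : C⦄ (g : b ⟶ c) (d : Fin n → R.obj (op b)), SqZero d →
      (resM R g F).mulVec d = (resM R g F').mulVec d) : F = F' := by
  ext i j
  have := affine_unique hKL (c := c) (u := fun o : Option (Fin n) => o.elim 0 (F i))
    (u' := fun o => o.elim 0 (F' i)) fun b g d hd => by
      have := congrFun (h g d hd) i
      simpa [Fintype.sum_option, Matrix.mulVec, dotProduct] using this
  exact congrFun this (some j)

namespace Chart

variable {c : C}

/-- The family `Γ` of matrices consists of the Christoffel symbols of the connection `L` in the
chart `χ`: it is natural, and `λ(p, p + d, p + e) = p + d + e + Γ(d) e`. -/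
structure IsChristoffel (χ : Chart J R M n c) (L : AffineConnection J R M)
    (Γ : ∀ ⦃b : C⦄, (b ⟶ c) → (Fin n → R.obj (op b)) →
      Fin n → Matrix (Fin n) (Fin n) (R.obj (op b))) : Prop where
  natural : ∀ ⦃a b : C⦄ (h : a ⟶ b) (g : b ⟶ c) (p : Fin n → R.obj (op b)), p ∈ χ.dom g →
    ∀ i, Γ (h ≫ g) (resV R h p) i = resM R h (Γ g p i)
  at_lam : ∀ ⦃b : C⦄ (g : b ⟶ c) (p d e : Fin n → R.obj (op b)) (x y z : M.obj (op b))
    (hy : Nbr J R M x y) (hz : Nbr J R M x z), χ.At g p x → SqZero d → χ.At g (p + d) y →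
    SqZero e → χ.At g (p + e) z →
      χ.At g (p + d + (1 + matForm (Γ g p) d).mulVec e) (L.lam x y z hy hz)

/-- With p and d fixed, the coordinates of λ(p, p + d, p + e) are affine in e by Kock–Lawvere. The
constant term is p + d because λ(x, y, x) = y. -/
theorem exists_transport (hKL : KockLawvere R) (χ : Chart J R M n c)
    (L : AffineConnection J R M) {b : C} (g : b ⟶ c) (p d : Fin n → R.obj (op b))
    (hp : p ∈ χ.dom g) (hd : SqZero d) :
    ∃ F : Matrix (Fin n) (Fin n) (R.obj (op b)), ∀ ⦃a : C⦄ (h : a ⟶ b)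
      (e : Fin n → R.obj (op a)) (x y z : M.obj (op a)) (hy : Nbr J R M x y)
      (hz : Nbr J R M x z), χ.At (h ≫ g) (resV R h p) x → χ.At (h ≫ g) (resV R h (p + d)) y →
      SqZero e → χ.At (h ≫ g) (resV R h p + e) z →
        χ.At (h ≫ g) (resV R h (p + d) + (resM R h F).mulVec e) (L.lam x y z hy hz) := by
  have hex : ∀ ⦃a : C⦄ (h : a ⟶ b) (e : Fin n → R.obj (op a)), ∃ q : Fin n → R.obj (op a),
      SqZero e → ∀ (x y z : M.obj (op a)) (hy : Nbr J R M x y) (hz : Nbr J R M x z),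
      χ.At (h ≫ g) (resV R h p) x → χ.At (h ≫ g) (resV R h (p + d)) y →
      χ.At (h ≫ g) (resV R h p + e) z → χ.At (h ≫ g) q (L.lam x y z hy hz) := by
    intro a h e
    by_cases he : SqZero e
    · have hp' := resV_mem_dom h hp
      obtain ⟨x, hx⟩ := exists_at hp'
      obtain ⟨y, hy⟩ := exists_at (resV_mem_dom h (mem_dom_add hp hd))
      obtain ⟨z, hz⟩ := exists_at (mem_dom_add hp' he)
      have hxy : Nbr J R M x y := by
        rw [resV_add] at hy
        exact hx.nbr hy (hd.resV h)
      have hxz : Nbr J R M x z := hx.nbr hz he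
      obtain ⟨q, hq⟩ := hy.exists_of_nbr (L.nbr_left x y z hxy hxz)
      refine ⟨q, fun _ x' y' z' hy' hz' hx'' hy'' hz'' => ?_⟩
      obtain rfl := hx.point_eq hx''
      obtain rfl := hy.point_eq hy''
      obtain rfl := hz.point_eq hz''
      exact hq
    · exact ⟨0, fun h => absurd h he⟩
  choose q hq using hex
  have hpts : ∀ ⦃a : C⦄ (h : a ⟶ b) (e : Fin n → R.obj (op a)), SqZero e →
      ∃ (x y z : M.obj (op a)) (_ : Nbr J R M x y) (_ : Nbr J R M x z),
      χ.At (h ≫ g) (resV R h p) x ∧ χ.At (h ≫ g) (resV R h (p + d)) y ∧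
      χ.At (h ≫ g) (resV R h p + e) z := by
    intro a h e he
    have hp' := resV_mem_dom h hp
    obtain ⟨x, hx⟩ := exists_at hp'
    obtain ⟨y, hy⟩ := exists_at (resV_mem_dom h (mem_dom_add hp hd))
    obtain ⟨z, hz⟩ := exists_at (mem_dom_add hp' he)
    have hy' := hy
    rw [resV_add] at hy'
    exact ⟨x, y, z, hx.nbr hy' (hd.resV h), hx.nbr hz he, hx, hy, hz⟩
  have haff : ∀ i, ∃ u : Option (Fin n) → R.obj (op b), ∀ ⦃a : C⦄ (h : a ⟶ b)
      (e : Fin n → R.obj (op a)), SqZero e → q h e i = ∑ o, resR R h (u o) * withOne e o := by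
    intro i
    refine exists_affine hKL (fun a h e => q h e i) fun a' a l h e he => ?_
    obtain ⟨x, y, z, hy, hz, hx', hy', hz'⟩ := hpts h e he
    have h1 := (hq h e he x y z hy hz hx' hy' hz').restrict l
    rw [← L.natural] at h1
    have e1 := hx'.restrict l
    have e2 := hy'.restrict l
    have e3 := hz'.restrict l
    rw [resV_add] at e3
    rw [resV_resV, ← Category.assoc] at e1 e2 e3
    rw [← Category.assoc] at h1
    exact congrFun ((hq (l ≫ h) _ (he.resV l) _ _ _ _ _ e1 e2 e3).coord_eq h1) i
  choose u hu using haff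
  have h0 : ∀ i, u i none = (p + d) i := by
    intro i
    obtain ⟨x, y, z, hy, hz, hx', hy', hz'⟩ := hpts (𝟙 b) 0 SqZero.zero
    have h1 := hq (𝟙 b) 0 SqZero.zero x y z hy hz hx' hy' hz'
    rw [add_zero] at hz'
    obtain rfl := hx'.point_eq hz'
    rw [L.unit_right] at h1
    have h2 := congrFun (h1.coord_eq hy') i
    rw [hu i _ _ SqZero.zero, resV_id] at h2
    simpa [Fintype.sum_option, resR_id] using h2
  refine ⟨fun i j => u i (some j), fun a h e x y z hy hz hx' hy' he hz' => ?_⟩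
  have h1 := hq h e he x y z hy hz hx' hy' hz'
  convert h1 using 1
  funext i
  rw [hu i h e he, Fintype.sum_option, h0]
  simp [Matrix.mulVec, dotProduct]
  rfl

/-- The transport matrix is in turn affine in d, with constant term 1 because λ(x, x, z) = z; its
linear part is Γ. Uniqueness of coefficients makes the construction natural. -/
theorem exists_isChristoffel (hKL : KockLawvere R) (χ : Chart J R M n c)
    (L : AffineConnection J R M) : ∃ Γ, χ.IsChristoffel L Γ := by
  have hex : ∀ ⦃b : C⦄ (g : b ⟶ c) (p d : Fin n → R.obj (op b)),
      ∃ F : Matrix (Fin n) (Fin n) (R.obj (op b)), p ∈ χ.dom g → SqZero d → ∀ ⦃a : C⦄ (h : a ⟶ b)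
      (e : Fin n → R.obj (op a)) (x y z : M.obj (op a)) (hy : Nbr J R M x y)
      (hz : Nbr J R M x z), χ.At (h ≫ g) (resV R h p) x → χ.At (h ≫ g) (resV R h (p + d)) y →
      SqZero e → χ.At (h ≫ g) (resV R h p + e) z →
        χ.At (h ≫ g) (resV R h (p + d) + (resM R h F).mulVec e) (L.lam x y z hy hz) := by
    intro b g p d
    by_cases hp : p ∈ χ.dom g
    · by_cases hd : SqZero d
      · obtain ⟨F, hF⟩ := exists_transport hKL χ L g p d hp hd
        exact ⟨F, fun _ _ => hF⟩
      · exact ⟨0, fun _ h => absurd h hd⟩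
    · exact ⟨0, fun h => absurd h hp⟩
  choose F hF using hex
  have hlam : ∀ ⦃a b : C⦄ (h : a ⟶ b) (g : b ⟶ c) (p d : Fin n → R.obj (op b)),
      p ∈ χ.dom g → SqZero d → ∀ e : Fin n → R.obj (op a), SqZero e →
      ∃ (x y z : M.obj (op a)) (hy : Nbr J R M x y) (hz : Nbr J R M x z),
        χ.At (h ≫ g) (resV R h p) x ∧ χ.At (h ≫ g) (resV R h (p + d)) y ∧
        χ.At (h ≫ g) (resV R h p + e) z ∧
        χ.At (h ≫ g) (resV R h (p + d) + (resM R h (F g p d)).mulVec e)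
          (L.lam x y z hy hz) := by
    intro a b h g p d hp hd e he
    have hp' := resV_mem_dom h hp
    obtain ⟨x, hx⟩ := exists_at hp'
    obtain ⟨y, hy⟩ := exists_at (resV_mem_dom h (mem_dom_add hp hd))
    obtain ⟨z, hz⟩ := exists_at (mem_dom_add hp' he)
    have hy' := hy
    rw [resV_add] at hy'
    exact ⟨x, y, z, hx.nbr hy' (hd.resV h), hx.nbr hz he, hx, hy, hz,
      hF g p d hp hd h e x y z _ _ hx hy he hz⟩
  have hnat : ∀ ⦃a b : C⦄ (h : a ⟶ b) (g : b ⟶ c) (p d : Fin n → R.obj (op b)),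
      p ∈ χ.dom g → SqZero d → F (h ≫ g) (resV R h p) (resV R h d) = resM R h (F g p d) := by
    intro a b h g p d hp hd
    refine matrix_ext_sqZero hKL fun a' l e he => ?_
    obtain ⟨x, y, z, hy, hz, hx', hy', hz', h1⟩ := hlam (l ≫ h) g p d hp hd e he
    rw [← resV_resV] at hx' hy' hz' h1
    rw [Category.assoc] at hx' hy' hz' h1
    rw [resV_add (g := h)] at hy' h1
    have h2 := hF (h ≫ g) _ _ (resV_mem_dom h hp) (hd.resV h) l e x y z hy hz hx' hy' he hz'
    have h3 := h2.coord_eq h1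
    rw [resM_resM]
    exact add_left_cancel h3
  have hone : ∀ ⦃b : C⦄ (g : b ⟶ c) (p : Fin n → R.obj (op b)), p ∈ χ.dom g → F g p 0 = 1 := by
    intro b g p hp
    refine matrix_ext_sqZero hKL fun a h e he => ?_
    obtain ⟨x, y, z, hy, hz, hx', hy', hz', h1⟩ := hlam h g p 0 hp SqZero.zero e he
    rw [add_zero] at hy' h1
    obtain rfl := hx'.point_eq hy'
    rw [L.unit_left] at h1
    rw [map_one, Matrix.one_mulVec]
    exact add_left_cancel (h1.coord_eq hz')
  have haff : ∀ ⦃b : C⦄ (g : b ⟶ c) (p : Fin n → R.obj (op b)),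
      ∃ Γ : Fin n → Matrix (Fin n) (Fin n) (R.obj (op b)), p ∈ χ.dom g →
      ∀ ⦃a : C⦄ (h : a ⟶ b) (d : Fin n → R.obj (op a)), SqZero d →
        F (h ≫ g) (resV R h p) d = 1 + matForm (fun i => resM R h (Γ i)) d := by
    intro b g p
    by_cases hp : p ∈ χ.dom g
    · have : ∀ i j, ∃ u : Option (Fin n) → R.obj (op b), ∀ ⦃a : C⦄ (h : a ⟶ b)
          (d : Fin n → R.obj (op a)), SqZero d →
            F (h ≫ g) (resV R h p) d i j = ∑ o, resR R h (u o) * withOne d o := by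
        intro i j
        refine exists_affine hKL (fun a h d => F (h ≫ g) (resV R h p) d i j) ?_
        intro a' a l h d hd
        have := hnat l (h ≫ g) (resV R h p) d (resV_mem_dom h hp) hd
        rw [resV_resV, ← Category.assoc] at this
        rw [this]
        rfl
      choose u hu using this
      refine ⟨fun k i j => u i j (some k), fun _ a h d hd => ?_⟩
      have h1 := hone g p hp
      ext i j
      have h0 := hu i j (𝟙 b) 0 SqZero.zero
      rw [Category.id_comp, resV_id, h1] at h0
      rw [hu i j h d hd]
      simp only [Fintype.sum_option, withOne_none, withOne_some, Pi.zero_apply, mul_zero,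
        Finset.sum_const_zero, add_zero, mul_one, resR_id] at h0
      simp [Fintype.sum_option, matForm, ← h0, Matrix.sum_apply, mul_comm, Matrix.one_apply,
        apply_ite]
      rfl
    · exact ⟨0, fun h => absurd h hp⟩
  choose Γ hΓ using haff
  refine ⟨Γ, ⟨fun a b h g p hp i => ?_, fun b g p d e x y z hy hz hx' hd hy' he hz' => ?_⟩⟩
  · ext j k
    have := affine_unique hKL (c := a)
      (u := fun o : Option (Fin n) => o.elim 0 fun i => Γ (h ≫ g) (resV R h p) i j k)
      (u' := fun o : Option (Fin n) => o.elim 0 fun i => resM R h (Γ g p i) j k) ?_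
    · exact congrFun this (some i)
    · intro a' l d hd
      have h1 := hΓ (h ≫ g) (resV R h p) (resV_mem_dom h hp) l d hd
      have h2 := hΓ g p hp (l ≫ h) d hd
      rw [resV_resV, ← Category.assoc, h2] at h1
      have h3 := add_left_cancel h1
      replace h3 := congrFun (congrFun h3 j) k
      simp only [matForm, Matrix.sum_apply, Matrix.smul_apply, smul_eq_mul] at h3
      simp only [Fintype.sum_option, Option.elim, withOne_none, withOne_some, map_zero, zero_mul,
        zero_add]
      have h4 : ∀ i, resR R l (resM R h (Γ g p i) j k) = resM R (l ≫ h) (Γ g p i) j k :=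
        fun i => resR_resR l h _
      simp only [h4]
      simp only [mul_comm]
      exact h3.symm
  · have h1 := hF g p d hx'.mem hd (𝟙 b) e x y z hy hz
    have h2 := hΓ g p hx'.mem (𝟙 b) d hd
    rw [Category.id_comp, resV_id] at h2
    simp only [resM_id] at h2
    rw [Category.id_comp, resV_id, resV_id, resM_id, h2] at h1
    exact h1 hx' hy' he hz'

end Chart

end Christoffel

/-! ### Symmetry and flatness in terms of Christoffel symbols -/

section AffineCoordinates

variable {C : Type u} [Category.{v} C] {J : GrothendieckTopology C}
  {R : Cᵒᵖ ⥤ CommAlgCat.{w} ℚ} {M : Cᵒᵖ ⥤ Type w'} {n : ℕ}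

variable (J R) in
/-- Points which are joined by a finite path of neighbours at the given stage. -/
def Linked (X : Cᵒᵖ ⥤ Type w') {c : C} (x y : X.obj (op c)) : Prop :=
  Relation.ReflTransGen (fun p q : X.obj (op c) => Nbr J R X p q) x y

/-- A map to an abelian group is an affine coordinate system around `x₀` if it is injective on the
points linked to `x₀` and takes `λ(x, y, z)` to `y - x + z`. -/
structure IsAffineCoord (L : AffineConnection J R M) {c : C} (x₀ : M.obj (op c)) {V : Type*}
    [AddCommGroup V] (φ : M.obj (op c) → V) : Prop where
  inj : ∀ ⦃y z : M.obj (op c)⦄, Linked J R M x₀ y → Linked J R M x₀ z → φ y = φ z → y = z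
  map_lam : ∀ ⦃x y z : M.obj (op c)⦄ (hy : Nbr J R M x y) (hz : Nbr J R M x z),
    Linked J R M x₀ x → φ (L.lam x y z hy hz) = φ y - φ x + φ z

namespace Chart

namespace IsChristoffel

variable {c : C} {χ : Chart J R M n c} {L : AffineConnection J R M}
  {Γ : ∀ ⦃b : C⦄, (b ⟶ c) → (Fin n → R.obj (op b)) →
    Fin n → Matrix (Fin n) (Fin n) (R.obj (op b))}

theorem resM_matForm (hΓ : χ.IsChristoffel L Γ) {a b : C} (h : a ⟶ b) {g : b ⟶ c}
    {p : Fin n → R.obj (op b)} (hp : p ∈ χ.dom g) (d : Fin n → R.obj (op b)) :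
    resM R h (matForm (Γ g p) d) = matForm (Γ (h ≫ g) (resV R h p)) (resV R h d) := by
  rw [SDG.resM_matForm]
  exact congrArg (fun G => matForm G _) (funext fun i => (hΓ.natural h g p hp i).symm)

theorem symm (hΓ : χ.IsChristoffel L Γ) (hsymm : L.Symmetric) {b : C} {g : b ⟶ c}
    {p d e : Fin n → R.obj (op b)} (hp : p ∈ χ.dom g) (hd : SqZero d) (he : SqZero e) :
    (matForm (Γ g p) d).mulVec e = (matForm (Γ g p) e).mulVec d := by
  obtain ⟨x, hx⟩ := exists_at hp
  obtain ⟨y, hy⟩ := exists_at (mem_dom_add hp hd)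
  obtain ⟨z, hz⟩ := exists_at (mem_dom_add hp he)
  have h1 := hΓ.at_lam g p d e x y z (hx.nbr hy hd) (hx.nbr hz he) hx hd hy he hz
  have h2 := hΓ.at_lam g p e d x z y (hx.nbr hz he) (hx.nbr hy hd) hx he hz hd hy
  rw [hsymm x z y] at h2
  have h3 := h1.coord_eq h2
  rw [Matrix.add_mulVec, Matrix.add_mulVec, Matrix.one_mulVec, Matrix.one_mulVec] at h3
  have h4 : p + d + e + (matForm (Γ g p) d).mulVec e = p + d + e + (matForm (Γ g p) e).mulVec d := by
    rw [add_assoc, h3]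
    abel
  exact add_left_cancel h4

/-- First-order Taylor expansion of Γ at p: on p + D(n) each entry is affine by Kock–Lawvere. -/
theorem exists_deriv (hΓ : χ.IsChristoffel L Γ) (hKL : KockLawvere R) {b : C} {g : b ⟶ c}
    {p : Fin n → R.obj (op b)} (hp : p ∈ χ.dom g) :
    ∃ D : Fin n → Fin n → Matrix (Fin n) (Fin n) (R.obj (op b)), ∀ ⦃a : C⦄ (h : a ⟶ b)
      (d : Fin n → R.obj (op a)), SqZero d → Γ (h ≫ g) (resV R h p + d) =
        fun i => Γ (h ≫ g) (resV R h p) i + ∑ m, d m • resM R h (D m i) := by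
  have haff : ∀ i j k, ∃ u : Option (Fin n) → R.obj (op b), ∀ ⦃a : C⦄ (h : a ⟶ b)
      (d : Fin n → R.obj (op a)), SqZero d →
        Γ (h ≫ g) (resV R h p + d) i j k = ∑ o, resR R h (u o) * withOne d o := by
    intro i j k
    refine exists_affine hKL (fun a h d => Γ (h ≫ g) (resV R h p + d) i j k) ?_
    intro a' a l h d hd
    have := hΓ.natural l (h ≫ g) (resV R h p + d) (mem_dom_add (resV_mem_dom h hp) hd) i
    rw [resV_add, resV_resV, ← Category.assoc] at this
    rw [this]
    rfl
  choose u hu using haff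
  refine ⟨fun m i j k => u i j k (some m), fun a h d hd => ?_⟩
  funext i
  ext j k
  have h0 := hu i j k h 0 SqZero.zero
  simp only [Fintype.sum_option, withOne_none, withOne_some, Pi.zero_apply, mul_zero,
    Finset.sum_const_zero, add_zero, mul_one] at h0
  rw [hu i j k h d hd, Matrix.add_apply, h0, Fintype.sum_option]
  simp [Matrix.sum_apply, mul_comm]
  rfl

/-- Flatness of `L` concerns mutual neighbours only; for p, p + d, p + d + d' this is the condition
that d, d' and d + d' all have square zero. -/
theorem flat_apply (hΓ : χ.IsChristoffel L Γ) (hflat : L.Flat) {b : C} {g : b ⟶ c}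
    {p d d' e : Fin n → R.obj (op b)} (hp : p ∈ χ.dom g) (hd : SqZero d) (hd' : SqZero d')
    (hdd : SqZero (d + d')) (he : SqZero e) :
    ((1 + matForm (Γ g (p + d)) d') * (1 + matForm (Γ g p) d)).mulVec e =
      (1 + matForm (Γ g p) (d + d')).mulVec e := by
  have hpd := mem_dom_add hp hd
  obtain ⟨x, hx⟩ := exists_at hp
  obtain ⟨y, hy⟩ := exists_at hpd
  obtain ⟨z, hz⟩ := exists_at (mem_dom_add hpd hd')
  obtain ⟨t, ht⟩ := exists_at (mem_dom_add hp he)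
  have hz' : χ.At g (p + (d + d')) z := by rwa [← add_assoc]
  have hxy := hx.nbr hy hd
  have hxt := hx.nbr ht he
  have h1 := hΓ.at_lam g p d e x y t hxy hxt hx hd hy he ht
  have h2 := hΓ.at_lam g (p + d) d' _ y z _ (hy.nbr hz hd') (L.nbr_left x y t hxy hxt) hy hd' hz
    (he.mulVec _) h1
  have h3 := hΓ.at_lam g p (d + d') e x z t (hx.nbr hz' hdd) hxt hx hdd hz' he ht
  rw [hflat x y z t _ _ (hx.nbr hz' hdd) _] at h2
  have h4 := h2.coord_eq h3
  rw [add_assoc p d d', Matrix.mulVec_mulVec] at h4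
  exact add_left_cancel h4

theorem flat_of_mutual (hΓ : χ.IsChristoffel L Γ) (hKL : KockLawvere R) (hflat : L.Flat) {b : C}
    {g : b ⟶ c} {p d d' : Fin n → R.obj (op b)} (hp : p ∈ χ.dom g) (hd : SqZero d)
    (hd' : SqZero d') (hdd : SqZero (d + d')) :
    (1 + matForm (Γ g (p + d)) d') * (1 + matForm (Γ g p) d) =
      1 + matForm (Γ g p) (d + d') := by
  refine matrix_ext_sqZero hKL fun a h e he => ?_
  rw [map_mul, map_add, map_add, map_add, map_one, hΓ.resM_matForm h (mem_dom_add hp hd),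
    hΓ.resM_matForm h hp, hΓ.resM_matForm h hp, resV_add, resV_add]
  refine hΓ.flat_apply hflat (resV_mem_dom h hp) (hd.resV h) (hd'.resV h) ?_ he
  rw [← resV_add]
  exact hdd.resV h

/-- Parallel transport along the two halves of an infinitesimal coordinate parallelogram is the
same. -/
theorem flat (hΓ : χ.IsChristoffel L Γ) (hKL : KockLawvere R) (hflat : L.Flat) {b : C}
    {g : b ⟶ c} {p d e : Fin n → R.obj (op b)} (hp : p ∈ χ.dom g) (hd : SqZero d)
    (he : SqZero e) :
    (1 + matForm (Γ g (p + d)) e) * (1 + matForm (Γ g p) d) =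
      (1 + matForm (Γ g (p + e)) d) * (1 + matForm (Γ g p) e) := by
  obtain ⟨D, hD⟩ := hΓ.exists_deriv hKL hp
  -- Vanishing of the curvature, coefficient by coefficient. It must be extracted from mutual
  -- neighbours, although the conclusion concerns unrelated d and e.
  have hB : ∀ i j, D i j + Γ g p j * Γ g p i = D j i + Γ g p i * Γ g p j := by
    intro i j
    by_cases hij : i = j
    · rw [hij]
    refine sub_eq_zero.1 (Matrix.ext fun k l => ?_)
    -- It suffices to kill the entry after multiplication by four independent scalars of square
    -- zero.
    refine eq_zero_of_mul_sqZero hKL _ fun a₁ h₁ e₁ he₁ => ?_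
    refine eq_zero_of_mul_sqZero hKL _ fun a₂ h₂ e₂ he₂ => ?_
    refine eq_zero_of_mul_sqZero hKL _ fun a₃ h₃ e₃ he₃ => ?_
    refine eq_zero_of_mul_sqZero hKL _ fun a₄ h₄ e₄ he₄ => ?_
    simp only [map_mul, resR_resR]
    generalize hh : h₄ ≫ h₃ ≫ h₂ ≫ h₁ = h
    have sq : ∀ {a a' : C} (f : a ⟶ a') {s : R.obj (op a')}, s * s = 0 →
        resR R f s * resR R f s = 0 := fun f s hs => by rw [← map_mul, hs, map_zero]
    replace he₁ := sq (h₄ ≫ h₃ ≫ h₂) he₁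
    replace he₂ := sq (h₄ ≫ h₃) he₂
    replace he₃ := sq h₄ he₃
    generalize resR R (h₄ ≫ h₃ ≫ h₂) e₁ = r₁ at he₁
    generalize resR R (h₄ ≫ h₃) e₂ = r₂ at he₂
    generalize resR R h₄ e₃ = r₃ at he₃
    have hp' := resV_mem_dom h hp
    -- Take d = r₁(r₂, -r₃) and d' = e₄(r₂, r₃) in the (i, j)-plane. Their sum has square zero
    -- because r₂r₃(e₄² - r₁²) = 0. In the quadratic term only the (i, j) and (j, i) coefficients
    -- survive, with opposite factors ±r₁r₂r₃e₄, which isolates the antisymmetric part.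
    have hd := sqZero_single_add_single (i := i) (j := j) (s := r₁ * r₂) (t := -(r₁ * r₃))
      (by linear_combination r₂ ^ 2 * he₁) (by linear_combination r₃ ^ 2 * he₁)
      (by linear_combination -(r₂ * r₃) * he₁)
    have hd' := sqZero_single_add_single (i := i) (j := j) (s := r₂ * e₄) (t := r₃ * e₄)
      (by linear_combination r₂ ^ 2 * he₄) (by linear_combination r₃ ^ 2 * he₄)
      (by linear_combination (r₂ * r₃) * he₄)
    have hdd : SqZero ((Pi.single i (r₁ * r₂) + Pi.single j (-(r₁ * r₃)) : Fin n → R.obj (op a₄)) +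
        (Pi.single i (r₂ * e₄) + Pi.single j (r₃ * e₄) : Fin n → R.obj (op a₄))) := by
      rw [add_add_add_comm, ← Pi.single_add, ← Pi.single_add]
      refine sqZero_single_add_single ?_ ?_ ?_
      · linear_combination (r₁ + e₄) ^ 2 * he₂
      · linear_combination (e₄ - r₁) ^ 2 * he₃
      · linear_combination -(r₂ * r₃) * he₁ + (r₂ * r₃) * he₄
    have h1 := hΓ.flat_of_mutual hKL hflat hp' hd hd' hdd
    rw [hD h _ hd, one_add_matForm_mul _ _ hd, ← matForm_add, sum_sum_single_smul] at h1
    have h2 := add_left_cancel (h1.trans (add_zero _).symm)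
    simp only [hΓ.natural h g p hp, ← map_mul, ← map_add] at h2
    have h3 := congrFun (congrFun h2 k) l
    simp only [Matrix.add_apply, Matrix.smul_apply, smul_eq_mul, Matrix.zero_apply] at h3
    have hentry : ∀ F : Matrix (Fin n) (Fin n) (R.obj (op b)),
        resM R h F k l = resR R h (F k l) := fun F => rfl
    rw [hentry, hentry, hentry, hentry] at h3
    rw [Matrix.sub_apply, map_sub]
    linear_combination h3 - r₁ * e₄ * resR R h ((D i i + Γ g p i * Γ g p i) k l) * he₂ +
      r₁ * e₄ * resR R h ((D j j + Γ g p j * Γ g p j) k l) * he₃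
  have hD' := hD (𝟙 b)
  simp only [Category.id_comp, resV_id, resM_id] at hD'
  rw [hD' d hd, hD' e he, one_add_matForm_mul _ _ hd, one_add_matForm_mul _ _ he,
    add_comm (matForm (Γ g p) d)]
  congr 1
  rw [Finset.sum_comm]
  refine Finset.sum_congr rfl fun i _ => Finset.sum_congr rfl fun j _ => ?_
  rw [hB j i, mul_comm]

/-- The first-order correction to Γ is bilinear in d and e, with coefficients multiplied by the
products d_m e_i. -/
theorem matForm_add_point (hΓ : χ.IsChristoffel L Γ) (hKL : KockLawvere R) {b : C}
    {g : b ⟶ c} {p d e : Fin n → R.obj (op b)} (hp : p ∈ χ.dom g) (hd : SqZero d)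
    (hde : ∀ i j, d i * e j = 0) : matForm (Γ g (p + d)) e = matForm (Γ g p) e := by
  obtain ⟨D, hD⟩ := hΓ.exists_deriv hKL hp
  have hD' := hD (𝟙 b) d hd
  simp only [Category.id_comp, resV_id, resM_id] at hD'
  rw [hD', matForm_deriv]
  simp [hde]

end IsChristoffel

end Chart

end AffineCoordinates

/-! ### Development of paths and affine coordinates -/

section AffineCoordinates

variable {C : Type u} [Category.{v} C] {J : GrothendieckTopology C}
  {R : Cᵒᵖ ⥤ CommAlgCat.{w} ℚ} {M : Cᵒᵖ ⥤ Type w'} {n : ℕ}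

namespace Chart.IsChristoffel

variable {c : C} {χ : Chart J R M n c} {L : AffineConnection J R M}
  {Γ : ∀ ⦃b : C⦄, (b ⟶ c) → (Fin n → R.obj (op b)) →
    Fin n → Matrix (Fin n) (Fin n) (R.obj (op b))}

/-- Development of a path, given by its coordinate increments, into the tangent space at its
starting point: the states consist of the current coordinates, the backward parallel transport to
the starting point, and the developed position. -/
def development (hΓ : χ.IsChristoffel L Γ) (hKL : KockLawvere R) (hsymm : L.Symmetric)
    (hflat : L.Flat) {p₀ : Fin n → R.obj (op c)} (hp₀ : p₀ ∈ χ.dom (𝟙 c)) :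
    CommutingSteps R n c where
  State b := (Fin n → R.obj (op b)) × Matrix (Fin n) (Fin n) (R.obj (op b)) ×
    (Fin n → R.obj (op b))
  restr _ _ h s := (resV R h s.1, resM R h s.2.1, resV R h s.2.2)
  Valid _ g s := s.1 ∈ χ.dom g
  step _ g s d := (s.1 + d, s.2.1 * (1 - matForm (Γ g s.1) d), s.2.2 + s.2.1.mulVec d)
  init _ g := (resV R g p₀, 1, 0)
  valid_init b g := by simpa using resV_mem_dom g hp₀
  restr_init a b h g := by simp only [resV_resV, map_one, resV_zero]
  valid_step b g s d hs hd := mem_dom_add hs hd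
  restr_step a b h g s d hs hd := by
    simp only [resV_add, map_mul, map_sub, map_one, hΓ.resM_matForm h hs, resV_mulVec]
  step_zero b g s hs := by simp [matForm_zero]
  step_comm := by
    intro b g s d e hs hd he
    have inv : ∀ {p d : Fin n → R.obj (op b)}, SqZero d →
        (1 + matForm (Γ g p) d) * (1 - matForm (Γ g p) d) = 1 ∧
          (1 - matForm (Γ g p) d) * (1 + matForm (Γ g p) d) = 1 := by
      intro p d hd
      have h := matForm_mul_matForm_eq_zero (Γ g p) (Γ g p) hd
      constructor <;> · noncomm_ring; simp [h]
    refine Prod.ext (add_right_comm _ _ _) (Prod.ext ?_ ?_)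
    -- The two backward transports are inverse to forward transports that coincide by flatness.
    · change s.2.1 * (1 - matForm (Γ g s.1) d) * (1 - matForm (Γ g (s.1 + d)) e) =
        s.2.1 * (1 - matForm (Γ g s.1) e) * (1 - matForm (Γ g (s.1 + e)) d)
      rw [mul_assoc, mul_assoc]
      congr 1
      refine left_inv_eq_right_inv
        (a := (1 + matForm (Γ g (s.1 + d)) e) * (1 + matForm (Γ g s.1) d)) ?_ ?_
      · rw [mul_assoc, ← mul_assoc _ (1 + matForm (Γ g (s.1 + d)) e), (inv he).2, one_mul,
          (inv hd).2]
      · rw [hΓ.flat hKL hflat hs hd he, mul_assoc, ← mul_assoc _ (1 - matForm (Γ g s.1) e),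
          (inv he).1, one_mul, (inv hd).1]
    -- Beyond the old position, both sides are the transport of d + e - Γ(d)e, which is symmetric in
    -- d and e.
    · change s.2.2 + s.2.1.mulVec d + (s.2.1 * (1 - matForm (Γ g s.1) d)).mulVec e =
        s.2.2 + s.2.1.mulVec e + (s.2.1 * (1 - matForm (Γ g s.1) e)).mulVec d
      rw [← Matrix.mulVec_mulVec, ← Matrix.mulVec_mulVec, add_assoc, add_assoc,
        ← Matrix.mulVec_add, ← Matrix.mulVec_add, Matrix.sub_mulVec, Matrix.sub_mulVec,
        hΓ.symm hsymm hs hd he, Matrix.one_mulVec, Matrix.one_mulVec]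
      congr 2
      abel

/-- The inverse of the development: the states consist of the current coordinates and the forward
parallel transport from the starting point. -/
def antiDevelopment (hΓ : χ.IsChristoffel L Γ) (hKL : KockLawvere R) (hsymm : L.Symmetric)
    (hflat : L.Flat) {p₀ : Fin n → R.obj (op c)} (hp₀ : p₀ ∈ χ.dom (𝟙 c)) :
    CommutingSteps R n c where
  State b := (Fin n → R.obj (op b)) × Matrix (Fin n) (Fin n) (R.obj (op b))
  restr _ _ h s := (resV R h s.1, resM R h s.2)
  Valid _ g s := s.1 ∈ χ.dom g
  step _ g s d := (s.1 + s.2.mulVec d, (1 + matForm (Γ g s.1) (s.2.mulVec d)) * s.2)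
  init _ g := (resV R g p₀, 1)
  valid_init b g := by simpa using resV_mem_dom g hp₀
  restr_init a b h g := by simp only [resV_resV, map_one]
  valid_step b g s d hs hd := mem_dom_add hs (hd.mulVec _)
  restr_step a b h g s d hs hd := by
    simp only [resV_add, map_mul, map_add, map_one, hΓ.resM_matForm h hs, resV_mulVec]
  step_zero b g s hs := by simp [matForm_zero]
  step_comm := by
    rintro b g ⟨p, F⟩ d e hs hd he
    change p ∈ χ.dom g at hs
    -- The second displacement is e + Γ(d)e. For its part Γ(d)e, neither the change of base point
    -- nor the factor 1 + Γ(d) matters, as both produce terms quadratic in d. The leftover Γ(Γ(d)e)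
    -- is symmetric in d and e, so flatness still gives commutation.
    have expand : ∀ {d e : Fin n → R.obj (op b)}, SqZero d → SqZero e →
        (1 + matForm (Γ g (p + d)) ((1 + matForm (Γ g p) d).mulVec e)) * (1 + matForm (Γ g p) d) =
          (1 + matForm (Γ g (p + d)) e) * (1 + matForm (Γ g p) d) +
            matForm (Γ g p) ((matForm (Γ g p) d).mulVec e) := by
      intro d e hd he
      have h0 := matForm_mulVec_mul_eq_zero (Γ g p) (e := e) hd
      rw [Matrix.add_mulVec, Matrix.one_mulVec, matForm_add, ← add_assoc, add_mul,
        hΓ.matForm_add_point hKL hs hd (e := (matForm (Γ g p) d).mulVec e)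
          fun i j => by rw [mul_comm, h0], mul_add (matForm _ _),
        matForm_mul_matForm_eq_zero _ _ h0, mul_one, add_zero]
    have h1 := hd.mulVec F
    have h2 := he.mulVec F
    simp only [← Matrix.mulVec_mulVec, ← mul_assoc]
    rw [expand h1 h2, expand h2 h1, hΓ.flat hKL hflat hs h1 h2, hΓ.symm hsymm hs h1 h2,
      Matrix.add_mulVec, Matrix.add_mulVec, Matrix.one_mulVec, Matrix.one_mulVec,
      hΓ.symm hsymm hs h1 h2]
    congr 1
    abel

/-- `(p, G, F, φ)` are the end point of a path from `p₀`, the backward and forward parallel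
transports along it, and its developed position. -/
structure Developed (hΓ : χ.IsChristoffel L Γ) (hKL : KockLawvere R) (hsymm : L.Symmetric)
    (hflat : L.Flat) {p₀ : Fin n → R.obj (op c)} (hp₀ : p₀ ∈ χ.dom (𝟙 c))
    (ds es : List (Fin n → R.obj (op c))) (p : Fin n → R.obj (op c))
    (G F : Matrix (Fin n) (Fin n) (R.obj (op c))) (φ : Fin n → R.obj (op c)) : Prop where
  sq_ds : ∀ d ∈ ds, SqZero d
  sq_es : ∀ e ∈ es, SqZero e
  run_ds : (hΓ.development hKL hsymm hflat hp₀).run (𝟙 c) (p₀, 1, 0) ds = (p, G, φ)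
  run_es : (hΓ.antiDevelopment hKL hsymm hflat hp₀).run (𝟙 c) (p₀, 1) es = (p, F)
  sum_ds : p₀ + ds.sum = p
  sum_es : es.sum = φ
  mul_inv : F * G = 1

variable (hΓ : χ.IsChristoffel L Γ) (hKL : KockLawvere R) (hsymm : L.Symmetric)
    (hflat : L.Flat) {p₀ : Fin n → R.obj (op c)} (hp₀ : p₀ ∈ χ.dom (𝟙 c))

theorem developed_nil : hΓ.Developed hKL hsymm hflat hp₀ [] [] p₀ 1 1 0 :=
  ⟨by simp, by simp, rfl, rfl, by simp, by simp, one_mul _⟩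

variable {hΓ hKL hsymm hflat hp₀} {ds es ds' es' : List (Fin n → R.obj (op c))}
  {p p' : Fin n → R.obj (op c)} {G F G' F' : Matrix (Fin n) (Fin n) (R.obj (op c))}
  {φ φ' : Fin n → R.obj (op c)}

/-- A coordinate step d matches the developed step Gd: the inverse process moves by F(Gd) = d
because FG = 1. So both processes follow the same path. -/
theorem Developed.append (h : hΓ.Developed hKL hsymm hflat hp₀ ds es p G F φ)
    {d : Fin n → R.obj (op c)} (hd : SqZero d) :
    hΓ.Developed hKL hsymm hflat hp₀ (ds ++ [d]) (es ++ [G.mulVec d]) (p + d)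
      (G * (1 - matForm (Γ (𝟙 c) p) d)) ((1 + matForm (Γ (𝟙 c) p) d) * F) (φ + G.mulVec d) := by
  have h0 := matForm_mul_matForm_eq_zero (Γ (𝟙 c) p) (Γ (𝟙 c) p) hd
  have h1 : (1 + matForm (Γ (𝟙 c) p) d) * (1 - matForm (Γ (𝟙 c) p) d) = 1 := by
    noncomm_ring; simp [h0]
  have hFG : F.mulVec (G.mulVec d) = d := by
    rw [Matrix.mulVec_mulVec, h.mul_inv, Matrix.one_mulVec]
  refine ⟨?_, ?_, ?_, ?_, ?_, ?_, ?_⟩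
  · intro e he
    rcases List.mem_append.1 he with he | he
    · exact h.sq_ds e he
    · rwa [List.mem_singleton.1 he]
  · intro e he
    rcases List.mem_append.1 he with he | he
    · exact h.sq_es e he
    · rw [List.mem_singleton.1 he]
      exact hd.mulVec G
  · exact (CommutingSteps.run_append_singleton _ _ _ _ _).trans (congrArg
      (fun s => (hΓ.development hKL hsymm hflat hp₀).step (𝟙 c) s d) h.run_ds)
  · refine (CommutingSteps.run_append_singleton _ _ _ _ _).trans ((congrArg
      (fun s => (hΓ.antiDevelopment hKL hsymm hflat hp₀).step (𝟙 c) s (G.mulVec d))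
      h.run_es).trans ?_)
    change (p + F.mulVec (G.mulVec d),
      (1 + matForm (Γ (𝟙 c) p) (F.mulVec (G.mulVec d))) * F) = _
    rw [hFG]
  · rw [List.sum_append, List.sum_singleton, ← add_assoc, h.sum_ds]
  · rw [List.sum_append, List.sum_singleton, h.sum_es]
  · rw [mul_assoc, ← mul_assoc F, h.mul_inv, one_mul, h1]

theorem Developed.mem (h : hΓ.Developed hKL hsymm hflat hp₀ ds es p G F φ) :
    p ∈ χ.dom (𝟙 c) := by
  have := (hΓ.development hKL hsymm hflat hp₀).valid_run (𝟙 c) ds (p₀, 1, 0) hp₀ h.sq_ds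
  rw [h.run_ds] at this
  exact this

/-- The developed position only depends on the end point of the path. -/
theorem Developed.position_eq (h : hΓ.Developed hKL hsymm hflat hp₀ ds es p G F φ)
    (h' : hΓ.Developed hKL hsymm hflat hp₀ ds' es' p G' F' φ') : φ = φ' := by
  have hsum : ds.sum = ds'.sum := add_left_cancel (h.sum_ds.trans h'.sum_ds.symm)
  funext i
  have := (hΓ.development hKL hsymm hflat hp₀).observe_eq hKL (fun b s => s.2.2 i)
    (fun a b h s => rfl) h.sq_ds h'.sq_ds hsum
  have hinit : (hΓ.development hKL hsymm hflat hp₀).init (𝟙 c) = (p₀, 1, 0) := by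
    simp [development, resV_id]
  rw [hinit, h.run_ds, h'.run_ds] at this
  exact this

/-- The end point of the path is determined by its developed position. -/
theorem Developed.endpoint_eq (h : hΓ.Developed hKL hsymm hflat hp₀ ds es p G F φ)
    (h' : hΓ.Developed hKL hsymm hflat hp₀ ds' es' p' G' F' φ) : p = p' := by
  have hsum : es.sum = es'.sum := h.sum_es.trans h'.sum_es.symm
  funext i
  have := (hΓ.antiDevelopment hKL hsymm hflat hp₀).observe_eq hKL (fun b s => s.1 i)
    (fun a b h s => rfl) h.sq_es h'.sq_es hsum
  have hinit : (hΓ.antiDevelopment hKL hsymm hflat hp₀).init (𝟙 c) = (p₀, 1) := by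
    simp [antiDevelopment, resV_id]
  rw [hinit, h.run_es, h'.run_es] at this
  exact this

end Chart.IsChristoffel

/-- In a chart, a symmetric and flat connection has affine coordinates around each point. -/
theorem Chart.At.exists_affineCoord (hR : Presieve.IsSheaf J (R ⋙ forget (CommAlgCat ℚ)))
    (hKL : KockLawvere R) {L : AffineConnection J R M} (hsymm : L.Symmetric) (hflat : L.Flat)
    {c : C} {χ : Chart J R M n c} {p₀ : Fin n → R.obj (op c)} {x₀ : M.obj (op c)}
    (hx₀ : χ.At (𝟙 c) p₀ x₀) :
    ∃ φ : M.obj (op c) → Fin n → R.obj (op c), IsAffineCoord L x₀ φ := by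
  obtain ⟨Γ, hΓ⟩ := exists_isChristoffel hKL χ L
  have hp₀ := hx₀.mem
  have hex : ∀ y : M.obj (op c), ∃ φ : Fin n → R.obj (op c), Linked J R M x₀ y →
      ∃ ds es p G F, χ.At (𝟙 c) p y ∧ hΓ.Developed hKL hsymm hflat hp₀ ds es p G F φ := by
    intro y
    by_cases hy : Linked J R M x₀ y
    · suffices ∃ φ, ∃ ds es p G F, χ.At (𝟙 c) p y ∧
          hΓ.Developed hKL hsymm hflat hp₀ ds es p G F φ from
        this.imp fun φ h _ => h
      induction hy with
      | refl => exact ⟨0, [], [], p₀, 1, 1, hx₀, hΓ.developed_nil hKL hsymm hflat hp₀⟩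
      | tail _ hyz ih =>
        obtain ⟨φ, ds, es, p, G, F, hp, hdev⟩ := ih
        obtain ⟨q, hq⟩ := hp.exists_of_nbr hyz
        have := hdev.append (hp.sqZero_of_nbr hR hKL hq hyz)
        rw [add_sub_cancel] at this
        exact ⟨_, _, _, _, _, _, hq, this⟩
    · exact ⟨0, fun h => absurd h hy⟩
  choose φ hφ using hex
  -- The chosen value of φ may be computed along any path to the point.
  have val : ∀ {y ds es p G F ψ}, Linked J R M x₀ y → χ.At (𝟙 c) p y →
      hΓ.Developed hKL hsymm hflat hp₀ ds es p G F ψ → φ y = ψ := by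
    intro y ds es p G F ψ hy hp hdev
    obtain ⟨_, _, p', _, _, hp', hdev'⟩ := hφ y hy
    obtain rfl := hp.coord_eq hp'
    exact hdev'.position_eq hdev
  refine ⟨φ, fun y z hy hz hyz => ?_, fun x y z hy hz hx => ?_⟩
  · obtain ⟨_, _, p, _, _, hp, hdev⟩ := hφ y hy
    obtain ⟨_, _, q, _, _, hq, hdev'⟩ := hφ z hz
    rw [hyz] at hdev
    obtain rfl := hdev.endpoint_eq hdev'
    exact hp.point_eq hq
  · obtain ⟨ds, es, p, G, F, hp, hdev⟩ := hφ x hx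
    obtain ⟨q, hq⟩ := hp.exists_of_nbr hy
    obtain ⟨r, hr⟩ := hp.exists_of_nbr hz
    obtain ⟨d, rfl⟩ : ∃ d, q = p + d := ⟨q - p, by rw [add_sub_cancel]⟩
    obtain ⟨e, rfl⟩ : ∃ e, r = p + e := ⟨r - p, by rw [add_sub_cancel]⟩
    have hd := hp.sqZero_of_nbr hR hKL hq hy
    have he := hp.sqZero_of_nbr hR hKL hr hz
    rw [add_sub_cancel_left] at hd he
    have hw := hΓ.at_lam _ p d e x y z hy hz hp hd hq he hr
    have hdd := hdev.append hd
    have h0 := matForm_mul_matForm_eq_zero (Γ (𝟙 c) p) (Γ (𝟙 c) p) hd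
    have h2 : (1 - matForm (Γ (𝟙 c) p) d) * (1 + matForm (Γ (𝟙 c) p) d) = 1 := by
      noncomm_ring; simp [h0]
    -- Go to λ(x, y, z) via y. The last increment is (1 + Γ(d))e, and its backward transport G(1 -
    -- Γ(d)) turns it into Ge, exactly the developed step from x to z.
    rw [val (hx.tail hy) hq hdd, val (hx.tail hz) hr (hdev.append he),
      val ((hx.tail hy).tail (L.nbr_left x y z hy hz)) hw (hdd.append (he.mulVec _)),
      Matrix.mulVec_mulVec, mul_assoc, h2, mul_one]
    abel

end AffineCoordinates

/-! ### Integral affine spaces and the operation y - x + z -/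

namespace AffineSpaceStructure

variable {X : Type*} (S : AffineSpaceStructure ℤ X)

theorem comb_congr {n : ℕ} {a a' : Fin n → ℤ} (h : a = a') (ha : ∑ i, a i = 1)
    (ha' : ∑ i, a' i = 1) (x : Fin n → X) : S.comb a ha x = S.comb a' ha' x := by
  subst h
  rfl

/-- The affine combination `y - x + z`. -/
def tern (y x z : X) : X := S.comb ![1, -1, 1] (by decide) ![y, x, z]

theorem sum_single_int {n : ℕ} (i : Fin n) : ∑ j, (Pi.single i 1 : Fin n → ℤ) j = 1 := by
  simp

theorem tern_comb {n : ℕ} {a b c : Fin n → ℤ} (ha : ∑ i, a i = 1) (hb : ∑ i, b i = 1)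
    (hc : ∑ i, c i = 1) (x : Fin n → X) (h : ∑ i, (a - b + c) i = 1) :
    S.tern (S.comb a ha x) (S.comb b hb x) (S.comb c hc x) = S.comb (a - b + c) h x := by
  have hB : ∀ i, ∑ j, (![a, b, c] : Fin 3 → Fin n → ℤ) i j = 1 := by
    intro i
    fin_cases i <;> assumption
  have hsum : (fun j => ∑ i, (![1, -1, 1] : Fin 3 → ℤ) i * (![a, b, c] : Fin 3 → Fin n → ℤ) i j) =
      a - b + c := by
    funext j
    simp [Fin.sum_univ_succ]
    ring
  have key := S.comb_comb ![1, -1, 1] ![a, b, c] x (by decide) hB (by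
    rw [Finset.sum_congr rfl fun j _ => congrFun hsum j]
    exact h)
  rw [S.comb_congr hsum _ h] at key
  rw [← key, tern]
  congr 1
  funext i
  fin_cases i <;> rfl

theorem tern_eq_comb {n : ℕ} (x : Fin n → X) (i j k : Fin n)
    (h : ∑ l, (Pi.single i 1 - Pi.single j 1 + Pi.single k 1 : Fin n → ℤ) l = 1) :
    S.tern (x i) (x j) (x k) = S.comb (Pi.single i 1 - Pi.single j 1 + Pi.single k 1) h x := by
  rw [← S.tern_comb (sum_single_int i) (sum_single_int j) (sum_single_int k), S.comb_single,
    S.comb_single, S.comb_single]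

theorem sum_single_sub_add_single {n : ℕ} (i j k : Fin n) :
    ∑ l, (Pi.single i 1 - Pi.single j 1 + Pi.single k 1 : Fin n → ℤ) l = 1 := by
  simp [Finset.sum_add_distrib]

theorem tern_self_right (y x : X) : S.tern y x x = y := by
  have := S.tern_eq_comb ![y, x] 0 1 1 (sum_single_sub_add_single _ _ _)
  rw [S.comb_congr (sub_add_cancel _ _) _ (sum_single_int _), S.comb_single] at this
  exact this

theorem tern_self_left (x z : X) : S.tern x x z = z := by
  have := S.tern_eq_comb ![x, z] 0 0 1 (sum_single_sub_add_single _ _ _)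
  rw [S.comb_congr (a' := Pi.single 1 1) (by simp) _ (sum_single_int _), S.comb_single] at this
  exact this

theorem tern_tern_left (y x z z' : X) : S.tern (S.tern y x z) z z' = S.tern y x z' := by
  have h1 := S.tern_eq_comb ![y, x, z, z'] 0 1 2 (sum_single_sub_add_single _ _ _)
  have h2 := S.tern_eq_comb ![y, x, z, z'] 0 1 3 (sum_single_sub_add_single _ _ _)
  have h3 := S.tern_comb (sum_single_sub_add_single 0 1 2) (sum_single_int 2) (sum_single_int 3)
    ![y, x, z, z'] (by decide)
  rw [← h1, S.comb_single, S.comb_single] at h3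
  refine h3.trans (Eq.trans ?_ h2.symm)
  exact S.comb_congr (by abel) _ _ _

theorem tern_tern_right (y x x' z : X) : S.tern y x' (S.tern x' x z) = S.tern y x z := by
  have h1 := S.tern_eq_comb ![y, x, x', z] 2 1 3 (sum_single_sub_add_single _ _ _)
  have h2 := S.tern_eq_comb ![y, x, x', z] 0 1 3 (sum_single_sub_add_single _ _ _)
  have h3 := S.tern_comb (sum_single_int 0) (sum_single_int 2) (sum_single_sub_add_single 2 1 3)
    ![y, x, x', z] (by decide)
  rw [← h1, S.comb_single, S.comb_single] at h3
  refine h3.trans (Eq.trans ?_ h2.symm)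
  exact S.comb_congr (by abel) _ _ _

/-- Integral affine combinations are determined by the combinations `y - x + z`. -/
theorem ext_of_tern {S S' : AffineSpaceStructure ℤ X} (h : ∀ y x z, S.tern y x z = S'.tern y x z) :
    S = S' := by
  have key : ∀ {n : ℕ} (a : Fin n → ℤ) (ha : ∑ i, a i = 1) (x : Fin n → X),
      S.comb a ha x = S'.comb a ha x := by
    intro n a ha x
    have hn : 0 < n := by
      rcases Nat.eq_zero_or_pos n with rfl | hn
      · simp at ha
      · exact hn
    let o : Fin n := ⟨0, hn⟩
    have hsum : ∀ k : Fin n → ℤ, ∑ i, (k + Pi.single o (1 - ∑ j, k j) : Fin n → ℤ) i = 1 := fun k => by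
      simp [Finset.sum_add_distrib]
    -- With `x o` as base point, a vector k of arbitrary sum is completed to coefficients of sum 1.
    -- Addition of vectors becomes u - o + v and negation becomes o - u + o, so agreement on ternary
    -- operations makes `P` a subgroup; it contains the unit vectors, hence everything.
    let P : AddSubgroup (Fin n → ℤ) :=
      { carrier := {k | S.comb _ (hsum k) x = S'.comb _ (hsum k) x}
        zero_mem' := by
          have : (0 : Fin n → ℤ) + Pi.single o (1 - ∑ j, (0 : Fin n → ℤ) j) = Pi.single o 1 := by
            simp
          change S.comb _ _ x = S'.comb _ _ x
          rw [S.comb_congr this _ (sum_single_int o), S'.comb_congr this _ (sum_single_int o),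
            S.comb_single, S'.comb_single]
        add_mem' := by
          intro k k' hk hk'
          have e : k + k' + Pi.single o (1 - ∑ j, (k + k') j) =
              (k + Pi.single o (1 - ∑ j, k j)) - Pi.single o 1 +
                (k' + Pi.single o (1 - ∑ j, k' j)) := by
            funext i
            simp only [Pi.add_apply, Pi.sub_apply, Pi.single_apply, Finset.sum_add_distrib]
            split_ifs <;> ring
          have hs : ∑ i, ((k + Pi.single o (1 - ∑ j, k j)) - Pi.single o 1 +
                (k' + Pi.single o (1 - ∑ j, k' j)) : Fin n → ℤ) i = 1 := by rw [← e]; exact hsum _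
          change S.comb _ _ x = S'.comb _ _ x
          rw [S.comb_congr e _ hs, S'.comb_congr e _ hs,
            ← S.tern_comb (hsum k) (sum_single_int o) (hsum k'),
            ← S'.tern_comb (hsum k) (sum_single_int o) (hsum k'), h, hk, hk', S.comb_single,
            S'.comb_single]
        neg_mem' := by
          intro k hk
          have e : -k + Pi.single o (1 - ∑ j, (-k) j) =
              Pi.single o 1 - (k + Pi.single o (1 - ∑ j, k j)) + Pi.single o 1 := by
            funext i
            simp only [Pi.add_apply, Pi.sub_apply, Pi.neg_apply, Pi.single_apply,
              Finset.sum_neg_distrib]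
            split_ifs <;> ring
          have hs : ∑ i, (Pi.single o 1 - (k + Pi.single o (1 - ∑ j, k j)) +
              Pi.single o 1 : Fin n → ℤ) i = 1 := by rw [← e]; exact hsum _
          change S.comb _ _ x = S'.comb _ _ x
          rw [S.comb_congr e _ hs, S'.comb_congr e _ hs,
            ← S.tern_comb (sum_single_int o) (hsum k) (sum_single_int o),
            ← S'.tern_comb (sum_single_int o) (hsum k) (sum_single_int o), h, hk, S.comb_single,
            S'.comb_single] }
    have hsingle : ∀ i, Pi.single i 1 ∈ P := by
      intro i
      have : (Pi.single i 1 : Fin n → ℤ) + Pi.single o (1 - ∑ j, (Pi.single i 1 : Fin n → ℤ) j) =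
          Pi.single i 1 := by simp
      change S.comb _ _ x = S'.comb _ _ x
      rw [S.comb_congr this _ (sum_single_int i), S'.comb_congr this _ (sum_single_int i),
        S.comb_single, S'.comb_single]
    have hmem : a ∈ P := by
      have : a = ∑ i, a i • (Pi.single i 1 : Fin n → ℤ) := by
        conv_lhs => rw [pi_eq_sum_univ' a]
      rw [this]
      exact P.sum_mem fun i _ => P.zsmul_mem (hsingle i) _
    have e : a + Pi.single o (1 - ∑ j, a j) = a := by simp [ha]
    have := (S.comb_congr e (hsum a) ha x).symm.trans (Eq.trans hmem (S'.comb_congr e _ ha x))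
    exact this
  cases S
  cases S'
  congr 1
  funext n a ha x
  exact key a ha x

end AffineSpaceStructure

/-- Subdivision of a parallelogram spanned by two paths into elementary parallelograms. The relation
`Q y x z w` stands for `w = y - x + z`. -/
theorem exists_parallelogram {X : Type*} {r : X → X → Prop} {Q : X → X → X → X → Prop}
    {good : X → Prop} (hgood : ∀ ⦃x y⦄, good x → r x y → good y)
    (unit_right : ∀ ⦃y x⦄, good y → good x → Q y x x y)
    (unit_left : ∀ ⦃x z⦄, good x → good z → Q x x z z)
    (base : ∀ ⦃x y z⦄, good x → r x y → r x z → ∃ w, r y w ∧ r z w ∧ Q y x z w)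
    (trans_left : ∀ ⦃y x z z' u w⦄, Q y x z u → Q u z z' w → Q y x z' w)
    (trans_right : ∀ ⦃y x x' z u w⦄, Q x' x z u → Q y x' u w → Q y x z w)
    {x y z : X} (hx : good x) (hy : Relation.ReflTransGen r x y)
    (hz : Relation.ReflTransGen r x z) : ∃ w, Relation.ReflTransGen r y w ∧ Q y x z w := by
  have hgood' : ∀ ⦃x y⦄, good x → Relation.ReflTransGen r x y → good y := by
    intro x y hx hy
    induction hy with
    | refl => exact hx
    | tail _ h ih => exact hgood ih h
  -- A strip one step wide: elementary cells are attached one after another along the path from x to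
  -- z. The strips are then stacked along the path from x to y.
  have row : ∀ ⦃x x' z⦄, good x → r x x' → Relation.ReflTransGen r x z →
      ∃ w, r z w ∧ Relation.ReflTransGen r x' w ∧ Q x' x z w := by
    intro x x' z hx hx' hz
    induction hz with
    | refl => exact ⟨x', hx', .refl, unit_right (hgood hx hx') hx⟩
    | tail h1 h2 ih =>
      obtain ⟨u, hu, hu', hQ⟩ := ih
      obtain ⟨w, hw, hw', hQ'⟩ := base (hgood' hx h1) hu h2
      exact ⟨w, hw', hu'.tail hw, trans_left hQ hQ'⟩
  induction hy using Relation.ReflTransGen.head_induction_on generalizing z with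
  | refl => exact ⟨z, hz, unit_left hx (hgood' hx hz)⟩
  | head h1 _ ih =>
    obtain ⟨u, -, hu, hQ⟩ := row hx h1 hz
    obtain ⟨w, hw, hQ'⟩ := ih (hgood hx h1) hu
    exact ⟨w, hw, trans_right hQ hQ'⟩

/-! ### Construction and uniqueness of the affine structure on a monad -/

section Gluing

variable {C : Type u} [Category.{v} C] {J : GrothendieckTopology C}
  {R : Cᵒᵖ ⥤ CommAlgCat.{w} ℚ} {M : Cᵒᵖ ⥤ Type w'}

theorem Linked.restrict {X : Cᵒᵖ ⥤ Type w'} {b c : C} {x y : X.obj (op c)}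
    (h : Linked J R X x y) (g : b ⟶ c) : Linked J R X (res X g x) (res X g y) :=
  h.lift (res X g) fun _ _ hxy => hxy.restrict J R g

theorem exists_covering_le {c : C} : ∀ {m : ℕ} (S : Fin m → Sieve c), (∀ i, S i ∈ J c) →
    ∃ T ∈ J c, ∀ i, T ≤ S i := by
  intro m
  induction m with
  | zero => exact fun S _ => ⟨⊤, J.top_mem c, fun i => i.elim0⟩
  | succ m ih =>
    intro S hS
    obtain ⟨T, hT, hle⟩ := ih (fun i => S i.succ) fun i => hS _
    exact ⟨S 0 ⊓ T, J.intersection_covering (hS 0) hT,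
      Fin.cases inf_le_left fun i => inf_le_right.trans (hle i)⟩

theorem exists_covering_linked {b : C} {x : M.obj (op b)} {m : ℕ} {y : Fin m → M.obj (op b)}
    (hy : ∀ i, NbrInfty J R M x (y i)) : ∃ S ∈ J b, ∀ ⦃a : C⦄ (h : a ⟶ b), S h →
      ∀ i, Linked J R M (res M h x) (res M h (y i)) := by
  choose S hS H using hy
  obtain ⟨T, hT, hle⟩ := exists_covering_le S hS
  exact ⟨T, hT, fun a h hh i => H i h (hle i _ hh)⟩

/-- `w` is the affine combination of the points `y i`, all linked to `x`, with coefficients `k i`,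
according to all affine coordinates at all later stages. -/
structure IsComb (L : AffineConnection J R M) {b : C} (x : M.obj (op b)) {m : ℕ} (k : Fin m → ℤ)
    (y : Fin m → M.obj (op b)) (w : M.obj (op b)) : Prop where
  linked : Linked J R M x w
  linked_arg : ∀ i, Linked J R M x (y i)
  coord : ∀ ⦃a : C⦄ (h : a ⟶ b) ⦃n : ℕ⦄ (φ : M.obj (op a) → Fin n → R.obj (op a)),
    IsAffineCoord L (res M h x) φ → φ (res M h w) = ∑ i, k i • φ (res M h (y i))

theorem IsComb.restrict {L : AffineConnection J R M} {b : C} {x : M.obj (op b)} {m : ℕ}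
    {k : Fin m → ℤ} {y : Fin m → M.obj (op b)} {w : M.obj (op b)} (H : IsComb L x k y w)
    {a : C} (h : a ⟶ b) : IsComb L (res M h x) k (fun i => res M h (y i)) (res M h w) where
  linked := H.linked.restrict h
  linked_arg i := (H.linked_arg i).restrict h
  coord a' l n φ hφ := by
    simp only [res_res] at hφ ⊢
    exact H.coord _ φ hφ

theorem IsAffineCoord.coord_lam {L : AffineConnection J R M} {a b : C} {x₀ : M.obj (op b)}
    {h : a ⟶ b} {n : ℕ} {φ : M.obj (op a) → Fin n → R.obj (op a)}
    (hφ : IsAffineCoord L (res M h x₀) φ) {x y z : M.obj (op b)} (hx : Linked J R M x₀ x)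
    (hy : Nbr J R M x y) (hz : Nbr J R M x z) :
    φ (res M h (L.lam x y z hy hz)) = φ (res M h y) - φ (res M h x) + φ (res M h z) := by
  rw [← L.natural]
  exact hφ.map_lam _ _ (hx.restrict h)

/-- Differences of points can be added, compatibly with all affine coordinates. -/
theorem exists_coord_parallelogram (L : AffineConnection J R M) {b : C} {x₀ x y z : M.obj (op b)}
    (hx : Linked J R M x₀ x) (hy : Linked J R M x y) (hz : Linked J R M x z) :
    ∃ w, Linked J R M y w ∧ ∀ ⦃a : C⦄ (h : a ⟶ b) ⦃n : ℕ⦄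
      (φ : M.obj (op a) → Fin n → R.obj (op a)), IsAffineCoord L (res M h x₀) φ →
        φ (res M h w) = φ (res M h y) - φ (res M h x) + φ (res M h z) := by
  refine exists_parallelogram (r := fun p q : M.obj (op b) => Nbr J R M p q)
    (Q := fun y x z w => ∀ ⦃a : C⦄ (h : a ⟶ b) ⦃n : ℕ⦄
      (φ : M.obj (op a) → Fin n → R.obj (op a)), IsAffineCoord L (res M h x₀) φ →
        φ (res M h w) = φ (res M h y) - φ (res M h x) + φ (res M h z))
    (good := Linked J R M x₀) (fun x y hx hxy => hx.tail hxy) ?_ ?_ ?_ ?_ ?_ hx hy hz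
  · intro y x _ _ a h n φ _
    abel
  · intro x z _ _ a h n φ _
    abel
  · exact fun x y z hx hy hz => ⟨L.lam x y z hy hz, L.nbr_left x y z hy hz, L.nbr_right x y z hy hz,
      fun a h n φ hφ => hφ.coord_lam hx hy hz⟩
  · intro y x z z' u w h1 h2 a h n φ hφ
    rw [h2 h φ hφ, h1 h φ hφ]
    abel
  · intro y x x' z u w h1 h2 a h n φ hφ
    rw [h2 h φ hφ, h1 h φ hφ]
    abel

theorem IsFormalManifold.linked_symm (hR : Presieve.IsSheaf J (R ⋙ forget (CommAlgCat ℚ)))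
    (hKL : KockLawvere R) (hman : IsFormalManifold J R M) {c : C} {x y : M.obj (op c)}
    (h : Linked J R M x y) : Linked J R M y x := by
  induction h with
  | refl => exact .refl
  | tail _ h ih => exact .head (hman.nbr_symm hR hKL h) ih

/-- The coefficient vectors k for which x + ∑ kᵢ(yᵢ - x) is realised form a subgroup. Sums come from
a parallelogram at x; negatives come from the parallelogram at w both of whose sides lead back to x,
giving x - w + x. When ∑ kᵢ = 1 the base point drops out. No coordinates need to exist here. -/
theorem exists_isComb (hR : Presieve.IsSheaf J (R ⋙ forget (CommAlgCat ℚ)))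
    (hKL : KockLawvere R) (hman : IsFormalManifold J R M) (L : AffineConnection J R M)
    {b : C} {x : M.obj (op b)} {m : ℕ} {k : Fin m → ℤ} (hk : ∑ i, k i = 1)
    {y : Fin m → M.obj (op b)} (hy : ∀ i, Linked J R M x (y i)) : ∃ w, IsComb L x k y w := by
  let P : AddSubgroup (Fin m → ℤ) :=
    { carrier := {k | ∃ w, Linked J R M x w ∧ ∀ ⦃a : C⦄ (h : a ⟶ b) ⦃n : ℕ⦄
        (φ : M.obj (op a) → Fin n → R.obj (op a)), IsAffineCoord L (res M h x) φ →
          φ (res M h w) = φ (res M h x) + ∑ i, k i • (φ (res M h (y i)) - φ (res M h x))}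
      zero_mem' := ⟨x, .refl, fun a h n φ _ => by simp⟩
      add_mem' := by
        rintro k k' ⟨w, hw, H⟩ ⟨w', hw', H'⟩
        obtain ⟨t, ht, Ht⟩ := exists_coord_parallelogram L .refl hw hw'
        refine ⟨t, hw.trans ht, fun a h n φ hφ => ?_⟩
        rw [Ht h φ hφ, H h φ hφ, H' h φ hφ]
        simp only [Pi.add_apply, add_smul, Finset.sum_add_distrib]
        abel
      neg_mem' := by
        rintro k ⟨w, hw, H⟩
        obtain ⟨t, ht, Ht⟩ := exists_coord_parallelogram L hw (hman.linked_symm hR hKL hw)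
          (hman.linked_symm hR hKL hw)
        refine ⟨t, ht, fun a h n φ hφ => ?_⟩
        rw [Ht h φ hφ, H h φ hφ]
        simp only [Pi.neg_apply, neg_smul, Finset.sum_neg_distrib]
        abel }
  have hsingle : ∀ i, Pi.single i 1 ∈ P := by
    refine fun i => ⟨y i, hy i, fun a h n φ _ => ?_⟩
    rw [Finset.sum_eq_single i (fun j _ hj => by simp [Pi.single_eq_of_ne hj]) (by simp)]
    simp
  have hmem : k ∈ P := by
    rw [pi_eq_sum_univ' k]
    exact P.sum_mem fun i _ => P.zsmul_mem (hsingle i) _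
  obtain ⟨w, hw, H⟩ := hmem
  refine ⟨w, hw, hy, fun a h n φ hφ => ?_⟩
  rw [H h φ hφ]
  simp only [smul_sub, Finset.sum_sub_distrib]
  rw [← Finset.sum_smul, hk, one_smul]
  abel

/-- Symmetric and flat connections on a formal manifold have affine coordinates locally. -/
theorem IsFormalManifold.exists_covering_affineCoord
    (hR : Presieve.IsSheaf J (R ⋙ forget (CommAlgCat ℚ)))
    (hKL : KockLawvere R) (hman : IsFormalManifold J R M) {L : AffineConnection J R M}
    (hsymm : L.Symmetric) (hflat : L.Flat) {b : C} (x : M.obj (op b)) :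
    ∃ S ∈ J b, ∀ ⦃a : C⦄ (h : a ⟶ b), S h →
      ∃ (n : ℕ) (φ : M.obj (op a) → Fin n → R.obj (op a)), IsAffineCoord L (res M h x) φ := by
  obtain ⟨S, hS, H⟩ := hman x
  refine ⟨S, hS, fun a h hh => ?_⟩
  obtain ⟨n, χ, ⟨p, hp⟩, hx⟩ := H h hh
  have hat : χ.At (𝟙 a) p (res M h x) := ⟨hp, hx⟩
  obtain ⟨φ, hφ⟩ := hat.exists_affineCoord hR hKL hsymm hflat
  exact ⟨n, φ, hφ⟩

/-- `w` is locally the affine combination of the points `y i` with coefficients `k i`. -/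
def IsLocComb (L : AffineConnection J R M) {b : C} (x : M.obj (op b)) {m : ℕ} (k : Fin m → ℤ)
    (y : Fin m → M.obj (op b)) (w : M.obj (op b)) : Prop :=
  ∃ S ∈ J b, ∀ ⦃a : C⦄ (h : a ⟶ b), S h →
    IsComb L (res M h x) k (fun i => res M h (y i)) (res M h w)

theorem IsLocComb.restrict {L : AffineConnection J R M} {b : C} {x : M.obj (op b)} {m : ℕ}
    {k : Fin m → ℤ} {y : Fin m → M.obj (op b)} {w : M.obj (op b)} (H : IsLocComb L x k y w)
    {a : C} (h : a ⟶ b) : IsLocComb L (res M h x) k (fun i => res M h (y i)) (res M h w) := by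
  obtain ⟨S, hS, H⟩ := H
  refine ⟨S.pullback h, J.pullback_stable h hS, fun a' l hl => ?_⟩
  simpa only [res_res] using H (l ≫ h) hl

theorem IsLocComb.nbrInfty {L : AffineConnection J R M} {b : C} {x : M.obj (op b)} {m : ℕ}
    {k : Fin m → ℤ} {y : Fin m → M.obj (op b)} {w : M.obj (op b)} (H : IsLocComb L x k y w) :
    NbrInfty J R M x w := by
  obtain ⟨S, hS, H⟩ := H
  exact ⟨S, hS, fun a h hh => (H h hh).linked⟩

/-- On a cover affine coordinates exist; there both points have the same coordinates, and these are
injective on linked points. -/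
theorem isLocComb_unique (hR : Presieve.IsSheaf J (R ⋙ forget (CommAlgCat ℚ)))
    (hKL : KockLawvere R) (hM : Presieve.IsSheaf J M) (hman : IsFormalManifold J R M)
    {L : AffineConnection J R M} (hsymm : L.Symmetric) (hflat : L.Flat)
    {b : C} {x : M.obj (op b)} {m : ℕ} {k : Fin m → ℤ}
    {y : Fin m → M.obj (op b)} {w w' : M.obj (op b)} (H : IsLocComb L x k y w)
    (H' : IsLocComb L x k y w') : w = w' := by
  obtain ⟨S, hS, H⟩ := H
  obtain ⟨S', hS', H'⟩ := H'
  obtain ⟨T, hT, HT⟩ := hman.exists_covering_affineCoord hR hKL hsymm hflat x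
  refine eq_of_locally_eq hM
    (J.intersection_covering hT (J.intersection_covering hS hS')) fun a h hh => ?_
  obtain ⟨n, φ, hφ⟩ := HT h hh.1
  have h1 := H h hh.2.1
  have h2 := H' h hh.2.2
  refine hφ.inj h1.linked h2.linked ?_
  have hφ' : IsAffineCoord L (res M (𝟙 a) (res M h x)) φ := by rwa [res_id]
  have e1 := h1.coord (𝟙 a) φ hφ'
  have e2 := h2.coord (𝟙 a) φ hφ'
  simp only [res_id] at e1 e2
  rw [e1, e2]

/-- The arguments are linked to x only on a cover. The combinations formed there are compatible by
`isLocComb_unique`, hence glue. -/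
theorem exists_isLocComb (hR : Presieve.IsSheaf J (R ⋙ forget (CommAlgCat ℚ)))
    (hKL : KockLawvere R) (hM : Presieve.IsSheaf J M) (hman : IsFormalManifold J R M)
    {L : AffineConnection J R M} (hsymm : L.Symmetric) (hflat : L.Flat)
    {b : C} {x : M.obj (op b)} {m : ℕ} {k : Fin m → ℤ}
    (hk : ∑ i, k i = 1) {y : Fin m → M.obj (op b)} (hy : ∀ i, NbrInfty J R M x (y i)) :
    ∃ w, IsLocComb L x k y w := by
  obtain ⟨S, hS, H⟩ := exists_covering_linked hy
  choose w hw using fun (a : C) (h : a ⟶ b) (hh : S h) =>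
    exists_isComb hR hKL hman L hk (H h hh)
  have locOf : ∀ {a : C} {x : M.obj (op a)} {y : Fin m → M.obj (op a)} {w : M.obj (op a)},
      IsComb L x k y w → IsLocComb L x k y w := fun h =>
    ⟨⊤, J.top_mem _, fun a' l _ => h.restrict l⟩
  let fam : Presieve.FamilyOfElements M S.arrows := fun a h hh => w a h hh
  have hcompat : fam.Compatible := by
    rw [Presieve.compatible_iff_sieveCompatible]
    intro a a' h l hh
    refine isLocComb_unique hR hKL hM hman hsymm hflat
      (locOf (hw a' (l ≫ h) (S.downward_closed hh l))) ?_
    have := locOf ((hw a h hh).restrict l)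
    simpa only [res_res] using this
  obtain ⟨t, ht, -⟩ := hM S hS fam hcompat
  refine ⟨t, S, hS, fun a h hh => ?_⟩
  have : res M h t = w a h hh := ht h hh
  rw [this]
  exact hw a h hh

theorem isLocComb_single (L : AffineConnection J R M) {b : C} {x : M.obj (op b)} {m : ℕ}
    (i : Fin m) {y : Fin m → M.obj (op b)} (hy : ∀ i, NbrInfty J R M x (y i)) :
    IsLocComb L x (Pi.single i 1) y (y i) := by
  obtain ⟨S, hS, H⟩ := exists_covering_linked hy
  refine ⟨S, hS, fun a h hh => ⟨H h hh i, H h hh, fun a' l n φ _ => ?_⟩⟩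
  rw [Finset.sum_eq_single i (fun j _ hj => by simp [Pi.single_eq_of_ne hj]) (by simp)]
  simp

theorem IsLocComb.comp {L : AffineConnection J R M} {b : C} {x : M.obj (op b)} {m n : ℕ}
    {k : Fin m → ℤ} {B : Fin m → Fin n → ℤ} {y : Fin n → M.obj (op b)} {u : Fin m → M.obj (op b)}
    {w : M.obj (op b)} (hw : IsLocComb L x k u w) (hu : ∀ i, IsLocComb L x (B i) y (u i))
    (hy : ∀ i, NbrInfty J R M x (y i)) : IsLocComb L x (fun j => ∑ i, k i * B i j) y w := by
  obtain ⟨S, hS, H⟩ := exists_covering_linked hy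
  obtain ⟨S', hS', H'⟩ := hw
  choose T hT HT using hu
  obtain ⟨T', hT', hle⟩ := exists_covering_le T hT
  refine ⟨S ⊓ (S' ⊓ T'), J.intersection_covering hS (J.intersection_covering hS' hT'),
    fun a h hh => ⟨(H' h hh.2.1).linked, H h hh.1, fun a' l n φ hφ => ?_⟩⟩
  rw [(H' h hh.2.1).coord l φ hφ, Finset.sum_congr rfl fun i _ => congrArg (k i • ·)
    ((HT i h (hle i _ hh.2.2)).coord l φ hφ)]
  simp only [Finset.smul_sum, Finset.sum_smul, mul_smul]
  exact Finset.sum_comm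

theorem isLocComb_lam (L : AffineConnection J R M) {b : C} {x₀ x y z : M.obj (op b)}
    (hx₀ : NbrInfty J R M x₀ x) (hy : Nbr J R M x y) (hz : Nbr J R M x z) :
    IsLocComb L x₀ ![1, -1, 1] ![y, x, z] (L.lam x y z hy hz) := by
  obtain ⟨S, hS, H⟩ := hx₀
  refine ⟨S, hS, fun a h hh => ?_⟩
  have hx : Linked J R M (res M h x₀) (res M h x) := H h hh
  have hy' := hy.restrict J R h
  have hz' := hz.restrict J R h
  rw [← L.natural]
  refine ⟨(hx.tail hy').tail (L.nbr_left _ _ _ hy' hz'), ?_, fun a' l n φ hφ => ?_⟩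
  · intro i
    fin_cases i
    exacts [hx.tail hy', hx, hx.tail hz']
  · rw [hφ.coord_lam hx hy' hz']
    simp [Fin.sum_univ_succ]
    abel

/-- The affine structure on an `∞`-monad given by the affine coordinates. -/
noncomputable def monadAffineStructure (hR : Presieve.IsSheaf J (R ⋙ forget (CommAlgCat ℚ)))
    (hKL : KockLawvere R) (hM : Presieve.IsSheaf J M) (hman : IsFormalManifold J R M)
    {L : AffineConnection J R M} (hsymm : L.Symmetric) (hflat : L.Flat)
    {c : C} (x₀ : M.obj (op c)) :
    AffineStructureOnMonad J R M x₀ :=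
  have hex := fun {b : C} (g : b ⟶ c) {n : ℕ} (k : Fin n → ℤ) (hk : ∑ i, k i = 1)
      (y : Fin n → inftyMonad J R M x₀ g) =>
    exists_isLocComb hR hKL hM hman hsymm hflat (x := res M g x₀) hk fun i => (y i).2
  { str := fun b g =>
      { comb := fun {n} k hk y => ⟨(hex g k hk y).choose, (hex g k hk y).choose_spec.nbrInfty⟩
        comb_single := fun {n} i y h => Subtype.ext <|
          isLocComb_unique hR hKL hM hman hsymm hflat (hex g _ h y).choose_spec
            (isLocComb_single L i fun i => (y i).2)
        comb_comb := fun {m n} a B y ha hB h => Subtype.ext <|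
          isLocComb_unique hR hKL hM hman hsymm hflat
            ((hex g a ha _).choose_spec.comp (fun i => (hex g (B i) (hB i) y).choose_spec)
              fun i => (y i).2)
            (hex g _ h y).choose_spec }
    natural := fun a b h g n k hk y => Subtype.ext <| by
      refine isLocComb_unique hR hKL hM hman hsymm hflat (x := res M (h ≫ g) x₀)
        (hex (h ≫ g) k hk _).choose_spec ?_
      have := (hex g k hk y).choose_spec.restrict h
      rwa [res_res] at this }

theorem monadAffineStructure_isLocComb (hR : Presieve.IsSheaf J (R ⋙ forget (CommAlgCat ℚ)))
    (hKL : KockLawvere R) (hM : Presieve.IsSheaf J M) (hman : IsFormalManifold J R M)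
    {L : AffineConnection J R M} (hsymm : L.Symmetric) (hflat : L.Flat)
    {c : C} (x₀ : M.obj (op c)) {b : C} (g : b ⟶ c) {n : ℕ}
    (k : Fin n → ℤ) (hk : ∑ i, k i = 1) (y : Fin n → inftyMonad J R M x₀ g) :
    IsLocComb L (res M g x₀) k (fun i => (y i).1)
      (((monadAffineStructure hR hKL hM hman hsymm hflat x₀).str g).comb k hk y).1 :=
  (exists_isLocComb hR hKL hM hman hsymm hflat hk fun i => (y i).2).choose_spec

theorem monadAffineStructure_extends (hR : Presieve.IsSheaf J (R ⋙ forget (CommAlgCat ℚ)))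
    (hKL : KockLawvere R) (hM : Presieve.IsSheaf J M) (hman : IsFormalManifold J R M)
    {L : AffineConnection J R M} (hsymm : L.Symmetric) (hflat : L.Flat)
    {c : C} (x₀ : M.obj (op c)) :
    (monadAffineStructure hR hKL hM hman hsymm hflat x₀).Extends L := by
  intro b g x y z hy hz
  refine isLocComb_unique hR hKL hM hman hsymm hflat (isLocComb_lam L x.2 hy hz) ?_
  convert monadAffineStructure_isLocComb hR hKL hM hman hsymm hflat x₀ g ![1, -1, 1] (by decide)
    ![y, x, z] using 1
  funext i
  fin_cases i <;> rfl

theorem NbrInfty.tail {X : Cᵒᵖ ⥤ Type w'} {c : C} {x y z : X.obj (op c)}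
    (hxy : NbrInfty J R X x y) (hyz : Nbr J R X y z) : NbrInfty J R X x z := by
  obtain ⟨S, hS, H⟩ := hxy
  exact ⟨S, hS, fun b g hg => (H g hg).tail (hyz.restrict J R g)⟩

theorem AffineStructureOnMonad.res_tern {c : C} {x₀ : M.obj (op c)}
    (A : AffineStructureOnMonad J R M x₀) {a b : C} (h : a ⟶ b) (g : b ⟶ c)
    (y x z : inftyMonad J R M x₀ g) :
    inftyMonad.res J R h g ((A.str g).tern y x z) = (A.str (h ≫ g)).tern
      (inftyMonad.res J R h g y) (inftyMonad.res J R h g x) (inftyMonad.res J R h g z) := by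
  rw [AffineSpaceStructure.tern, ← A.natural, AffineSpaceStructure.tern]
  congr 1
  funext i
  fin_cases i <;> rfl

/-- The parallelogram is subdivided for both structures at once: on elementary cells both give λ,
and pasting uses laws valid in every affine space. Both values therefore equal the same corner w. -/
theorem tern_eq_of_linked {L : AffineConnection J R M} {c : C} {x₀ : M.obj (op c)}
    {A A' : AffineStructureOnMonad J R M x₀} (hA : A.Extends L) (hA' : A'.Extends L) {b : C}
    (g : b ⟶ c) (y x z : inftyMonad J R M x₀ g) (hy : Linked J R M x.1 y.1)
    (hz : Linked J R M x.1 z.1) : (A.str g).tern y x z = (A'.str g).tern y x z := by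
  obtain ⟨w, -, _, _, _, _, h1, h2⟩ := exists_parallelogram
    (r := fun p q : M.obj (op b) => Nbr J R M p q) (good := (· ∈ inftyMonad J R M x₀ g))
    (Q := fun y x z w => ∃ (hy : y ∈ inftyMonad J R M x₀ g) (hx : x ∈ inftyMonad J R M x₀ g)
      (hz : z ∈ inftyMonad J R M x₀ g) (hw : w ∈ inftyMonad J R M x₀ g),
      (A.str g).tern ⟨y, hy⟩ ⟨x, hx⟩ ⟨z, hz⟩ = ⟨w, hw⟩ ∧
        (A'.str g).tern ⟨y, hy⟩ ⟨x, hx⟩ ⟨z, hz⟩ = ⟨w, hw⟩)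
    (fun x y hx hxy => NbrInfty.tail hx hxy)
    (fun y x hy hx => ⟨hy, hx, hx, hy, AffineSpaceStructure.tern_self_right _ _ _,
      AffineSpaceStructure.tern_self_right _ _ _⟩)
    (fun x z hx hz => ⟨hx, hx, hz, hz, AffineSpaceStructure.tern_self_left _ _ _,
      AffineSpaceStructure.tern_self_left _ _ _⟩)
    (fun x y z hx hy hz => ⟨L.lam x y z hy hz, L.nbr_left x y z hy hz, L.nbr_right x y z hy hz,
      NbrInfty.tail hx hy, hx, NbrInfty.tail hx hz,
      NbrInfty.tail (NbrInfty.tail hx hy) (L.nbr_left x y z hy hz),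
      Subtype.ext (hA g ⟨x, hx⟩ ⟨y, NbrInfty.tail hx hy⟩ ⟨z, NbrInfty.tail hx hz⟩ hy hz).symm,
      Subtype.ext (hA' g ⟨x, hx⟩ ⟨y, NbrInfty.tail hx hy⟩ ⟨z, NbrInfty.tail hx hz⟩ hy hz).symm⟩)
    (by
      rintro y x z z' u w ⟨hy, hx, hz, hu, h1, h1'⟩ ⟨_, _, hz', hw, h2, h2'⟩
      refine ⟨hy, hx, hz', hw, ?_, ?_⟩
      · rw [← h2, ← h1, AffineSpaceStructure.tern_tern_left]
      · rw [← h2', ← h1', AffineSpaceStructure.tern_tern_left])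
    (by
      rintro y x x' z u w ⟨hx', hx, hz, hu, h1, h1'⟩ ⟨hy, _, _, hw, h2, h2'⟩
      refine ⟨hy, hx, hz, hw, ?_, ?_⟩
      · rw [← h2, ← h1, AffineSpaceStructure.tern_tern_right]
      · rw [← h2', ← h1', AffineSpaceStructure.tern_tern_right])
    x.2 hy hz
  exact h1.trans h2.symm

/-- Any three points of the monad are linked to one another on a cover, linking being symmetric. The
ternary operations agree there, hence everywhere by separatedness, and they determine all integral
combinations. -/
theorem affineStructure_unique (hR : Presieve.IsSheaf J (R ⋙ forget (CommAlgCat ℚ)))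
    (hKL : KockLawvere R) (hM : Presieve.IsSheaf J M) (hman : IsFormalManifold J R M) {L : AffineConnection J R M}
    {c : C} {x₀ : M.obj (op c)} {A A' : AffineStructureOnMonad J R M x₀}
    (hA : A.Extends L) (hA' : A'.Extends L) : A = A' := by
  have htern : ∀ ⦃b : C⦄ (g : b ⟶ c) (y x z : inftyMonad J R M x₀ g),
      (A.str g).tern y x z = (A'.str g).tern y x z := by
    intro b g y x z
    obtain ⟨S, hS, H⟩ := exists_covering_linked (y := fun i => (![y, x, z] i).1)
      fun i => (![y, x, z] i).2
    refine Subtype.ext (eq_of_locally_eq hM hS fun a h hh => ?_)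
    have hx := hman.linked_symm hR hKL (H h hh 1)
    have key := tern_eq_of_linked hA hA' (h ≫ g) (inftyMonad.res J R h g y)
      (inftyMonad.res J R h g x) (inftyMonad.res J R h g z) (hx.trans (H h hh 0))
      (hx.trans (H h hh 2))
    rw [← A.res_tern, ← A'.res_tern] at key
    exact congrArg Subtype.val key
  cases A
  cases A'
  congr 1
  funext b g
  exact AffineSpaceStructure.ext_of_tern (htern g)

end Gluing

end SDG

theorem theorem3p7 {C : Type u} [Category.{v} C] (J : GrothendieckTopology C)
    (R : Cᵒᵖ ⥤ CommAlgCat.{w} ℚ)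
    (hR : Presieve.IsSheaf J (R ⋙ forget (CommAlgCat ℚ)))
    (hKL : SDG.KockLawvere R)
    (M : Cᵒᵖ ⥤ Type w') (hM : Presieve.IsSheaf J M)
    (hman : SDG.IsFormalManifold J R M)
    (L : SDG.AffineConnection J R M) (hsymm : L.Symmetric) (hflat : L.Flat)
    {c : C} (x₀ : M.obj (op c)) :
    ∃! A : SDG.AffineStructureOnMonad J R M x₀, A.Extends L :=
  ⟨SDG.monadAffineStructure hR hKL hM hman hsymm hflat x₀,
    SDG.monadAffineStructure_extends hR hKL hM hman hsymm hflat x₀,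
    fun _ hA => SDG.affineStructure_unique hR hKL hM hman hA
      (SDG.monadAffineStructure_extends hR hKL hM hman hsymm hflat x₀)⟩
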